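/- **Setting.** Let $M=\mathbb T^N=\mathbb R^N/\mathbb Z^N$ be the flat torus. Let $H_1,\dots,H_m:M\times\mathbb R^N\to\mathbb R$ be continuous, convex in $p$, and such that for each $i$ there are functions $\alpha,\beta$ on $[0,\infty)$ with $\alpha(h)/h\to+\infty$, $\beta(h)/h\to+\infty$ as $h\to+\infty$ and $\alpha(|p|)\le H_i(x,p)\le\beta(|p|)$ for all $(x,p)$. Let $B=(b_{ij})$ be a real $m\times m$ matrix with $b_{ij}\le 0$ for $i\ne j$ and $\sum_j b_{ij}=0$ for every $i$, which is irreducible: for every nonempty proper subset $I$ of $\{1,\dots,m\}$ there are $i\in I$, $j\notin I$ with $b_{ij}\ne0$. For $\lambda\ge0$ and $c\in\mathbb R$ consider the system $$\big((B+\lambda\,\mathrm{Id})\mathbf u(x)\big)_i+H_i(x,Du_i(x))=c\qquad (x\in M,\ i=1,\dots,m), \tag{$S_{\lambda,c}$}$$ with continuous (sub/super)solutions $\mathbf u:M\to\mathbb R^m$ understood in the viscosity sense. Let $c(\mathbb H)$ be the critical value, i.e. the unique $c$ for which $(S_{0,c})$ has a solution; for $\lambda>0$ let $\mathbf u^\lambda$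 be the unique solution of $(S_{\lambda,c(\mathbb H)})$. Let $L_i(x,v)=\sup_{p\in\mathbb R^N}\{\langle p,v\rangle-H_i(x,p)\}$. A Borel probability measure $\mu$ on $TM\times\{1,\dots,m\}=M\times\mathbb R^N\times\{1,\dots,m\}$ is called closed if $\int|v|\,d\mu<+\infty$ and $\int \big(B\boldsymbol\phi(x)\big)_i+\langle D\phi_i(x),v\rangle\,d\mu(x,v,i)=0$ for every $\boldsymbol\phi\in (C^1(M))^m$. A Mather measure is a closed probability measure that minimizes $\int L_i(x,v)\,d\mu(x,v,i)$ among all closed probability measures. Let $\mathcal F$ be the set of continuous viscosity subsolutions $\mathbf w$ of $(S_{0,c(\mathbb H)})$ such that $\int w_i(x)\,d\mu(x,v,i)\le0$ for every Mather measure $\mu$, and let $u^0_i(x)=\sup_{\mathbf w\in\mathcal F}w_i(x)$. **Proposition.** Let $\mathbf u:M\to\mathbb R^m$ be a Lipschitz function that is the uniform limit of $\mathbf u^{\lambda_k}$ for some sequence $\lambda_k>0$ with $\lambda_k\to0$. Then $$\int_{TM\times\{1,\dots,m\}}u_i(x)\,d\mu(x,v,i)\le0\qquad\text{for every Mather measure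 }\mu .$$ In particular, the suprema defining $\mathbf u^0$ being finite, $u_i(x)\le u^0_i(x)$ for every $x\in M$ and $i\in\{1,\dots,m\}$. -/

import Mathlib

open MeasureTheory Filter Topology
open scoped Matrix

noncomputable section

namespace HJSystem

/-- The flat torus `𝕋^N = ℝ^N / ℤ^N`, with its quotient topology and Borel `σ`-algebra. -/
abbrev Torus (N : ℕ) : Type := UnitAddTorus (Fin N)

/-- `ℝ^N` with the Euclidean norm: every tangent and every cotangent space of the torus. -/
abbrev Vec (N : ℕ) : Type := EuclideanSpace ℝ (Fin N)

/-- The space `TM × {1,…,m}` of triples `(x, v, i)`. -/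
abbrev Phase (N m : ℕ) : Type := Torus N × Vec N × Fin m

/-- The Banach space `(C(M))^m` with the norm `max_i ‖u_i‖_∞`. -/
abbrev VecFun (N m : ℕ) : Type := C(Torus N, Fin m → ℝ)

/-- The quotient map `ℝ^N → 𝕋^N`. -/
def proj {N : ℕ} (h : Vec N) : Torus N := fun j => ((h j : ℝ) : UnitAddCircle)

/-! ### Assumptions on the Hamiltonians and on the coupling matrix -/

/-- A function on `[0,∞)` is superlinear if `f(h)/h → +∞` as `h → +∞`
(values at negative numbers play no role). -/
def Superlinear (f : ℝ → ℝ) : Prop := Tendsto (fun h : ℝ => f h / h) atTop atTop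

/-- The Hamiltonians `H_1,…,H_m` are continuous on `T^*M`, convex in `p`, and bounded from below
and above by superlinear functions of `|p|`. -/
structure HamiltonianAssumptions {N m : ℕ} (H : Fin m → Torus N → Vec N → ℝ) : Prop where
  continuous : ∀ i, Continuous fun z : Torus N × Vec N => H i z.1 z.2
  convex : ∀ i x, ConvexOn ℝ Set.univ (H i x)
  superlinear : ∀ i, ∃ α β : ℝ → ℝ, Superlinear α ∧ Superlinear β ∧
    ∀ x p, α ‖p‖ ≤ H i x p ∧ H i x p ≤ β ‖p‖

/-- The coupling matrix has nonpositive off-diagonal entries, rows summing to zero, and is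
irreducible. -/
structure CouplingAssumptions {m : ℕ} (B : Matrix (Fin m) (Fin m) ℝ) : Prop where
  offDiag_nonpos : ∀ i j, j ≠ i → B i j ≤ 0
  row_sum : ∀ i, ∑ j, B i j = 0
  irreducible : ∀ I : Set (Fin m), I.Nonempty → I ≠ Set.univ → ∃ i ∈ I, ∃ j ∉ I, B i j ≠ 0

/-! ### Viscosity solutions -/

/-- The superdifferential `D⁺f(x)`: all `p` with `f(x+h) ≤ f(x) + ⟨p,h⟩ + o(|h|)` as `h → 0`. -/
def superdiff {N : ℕ} (f : Torus N → ℝ) (x : Torus N) : Set (Vec N) :=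
  {p | ∀ ε > 0, ∀ᶠ h : Vec N in 𝓝 0, f (x + proj h) ≤ f x + inner ℝ p h + ε * ‖h‖}

/-- The subdifferential `D⁻f(x)`: all `p` with `f(x+h) ≥ f(x) + ⟨p,h⟩ - o(|h|)` as `h → 0`. -/
def subdiff {N : ℕ} (f : Torus N → ℝ) (x : Torus N) : Set (Vec N) :=
  {p | ∀ ε > 0, ∀ᶠ h : Vec N in 𝓝 0, f x + inner ℝ p h - ε * ‖h‖ ≤ f (x + proj h)}

/-- `u` is a viscosity subsolution of `(B + λ Id) u + H(x, Du) = c 𝟙` in `M`. -/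
def IsSubsolution {N m : ℕ} (H : Fin m → Torus N → Vec N → ℝ) (B : Matrix (Fin m) (Fin m) ℝ)
    (lam c : ℝ) (u : VecFun N m) : Prop :=
  ∀ x i, ∀ p ∈ superdiff (fun y => u y i) x,
    H i x p + ((B + lam • (1 : Matrix (Fin m) (Fin m) ℝ)) *ᵥ u x) i ≤ c

/-- `u` is a viscosity supersolution of `(B + λ Id) u + H(x, Du) = c 𝟙` in `M`. -/
def IsSupersolution {N m : ℕ} (H : Fin m → Torus N → Vec N → ℝ) (B : Matrix (Fin m) (Fin m) ℝ)
    (lam c : ℝ) (u : VecFun N m) : Prop :=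
  ∀ x i, ∀ p ∈ subdiff (fun y => u y i) x,
    c ≤ H i x p + ((B + lam • (1 : Matrix (Fin m) (Fin m) ℝ)) *ᵥ u x) i

/-- `u` is a viscosity solution of `(B + λ Id) u + H(x, Du) = c 𝟙` in `M`. -/
def IsSolution {N m : ℕ} (H : Fin m → Torus N → Vec N → ℝ) (B : Matrix (Fin m) (Fin m) ℝ)
    (lam c : ℝ) (u : VecFun N m) : Prop :=
  IsSubsolution H B lam c u ∧ IsSupersolution H B lam c u

/-- The critical value `c(H)`: the unique `c` for which the system with `λ = 0` has a solution.
(The set below is a singleton for Hamiltonians and coupling matrices as above; `sInf` picks out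
its element.) -/
def criticalValue {N m : ℕ} (H : Fin m → Torus N → Vec N → ℝ)
    (B : Matrix (Fin m) (Fin m) ℝ) : ℝ :=
  sInf {c : ℝ | ∃ u : VecFun N m, IsSolution H B 0 c u}

/-- The set `𝔖` of the Lipschitz functions that are limits in `(C(M))^m` of the solutions of the
discounted systems `(B + λ_k Id) u + H(x, Du) = c(H) 𝟙` along a sequence `λ_k → 0⁺`. (For each
`λ > 0` the solution is unique. Being Lipschitz does not depend on the choice between the
Euclidean distance on the torus and the equivalent distance used by Mathlib.) -/
def limitSet {N m : ℕ} (H : Fin m → Torus N → Vec N → ℝ)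
    (B : Matrix (Fin m) (Fin m) ℝ) : Set (VecFun N m) :=
  {u | (∃ K, LipschitzWith K u) ∧
    ∃ (lam : ℕ → ℝ) (v : ℕ → VecFun N m),
      (∀ k, 0 < lam k) ∧ Tendsto lam atTop (𝓝 0) ∧
      (∀ k, IsSolution H B (lam k) (criticalValue H B) (v k)) ∧
      Tendsto v atTop (𝓝 u)}

/-! ### Mather measures -/

/-- The Lagrangian `L_i(x,v) = sup_p (⟨p,v⟩ - H_i(x,p))`. -/
def lagrangian {N m : ℕ} (H : Fin m → Torus N → Vec N → ℝ) (i : Fin m) (x : Torus N)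
    (v : Vec N) : ℝ :=
  ⨆ p : Vec N, (inner ℝ p v - H i x p)

/-- `f` is of class `C¹` on the torus: its periodic lift to `ℝ^N` is. -/
def IsC1 {N : ℕ} (f : Torus N → ℝ) : Prop := ContDiff ℝ 1 fun y : Vec N => f (proj y)

/-- The differential of `f` at `x` applied to the tangent vector `v`, i.e. `⟨Df(x), v⟩`. -/
def dirDeriv {N : ℕ} (f : Torus N → ℝ) (x : Torus N) (v : Vec N) : ℝ :=
  fderiv ℝ (fun h : Vec N => f (x + proj h)) 0 v

/-- Closed probability measures on `TM × {1,…,m}`. -/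
structure IsClosedMeasure {N m : ℕ} (B : Matrix (Fin m) (Fin m) ℝ)
    (μ : Measure (Phase N m)) : Prop where
  prob : IsProbabilityMeasure μ
  integrable_norm : Integrable (fun z : Phase N m => ‖z.2.1‖) μ
  closed : ∀ φ : Torus N → Fin m → ℝ, (∀ i, IsC1 fun x => φ x i) →
    ∫ z : Phase N m, ((B *ᵥ φ z.1) z.2.2 + dirDeriv (fun x => φ x z.2.2) z.1 z.2.1) ∂μ = 0

/-- Mather measures: closed probability measures that minimize `∫ L_i(x,v) dμ` among all closed
probability measures. The Lagrangian is bounded from below; a measure for which it is not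
integrable has action `+∞`, so it is no minimizer and no competitor. -/
structure IsMatherMeasure {N m : ℕ} (H : Fin m → Torus N → Vec N → ℝ)
    (B : Matrix (Fin m) (Fin m) ℝ) (μ : Measure (Phase N m)) : Prop where
  closed : IsClosedMeasure B μ
  integrable : Integrable (fun z : Phase N m => lagrangian H z.2.2 z.1 z.2.1) μ
  minimal : ∀ ν : Measure (Phase N m), IsClosedMeasure B ν →
    Integrable (fun z : Phase N m => lagrangian H z.2.2 z.1 z.2.1) ν →
    ∫ z : Phase N m, lagrangian H z.2.2 z.1 z.2.1 ∂μ
      ≤ ∫ z : Phase N m, lagrangian H z.2.2 z.1 z.2.1 ∂ν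

/-! ### The candidate limit `u⁰` -/

/-- The family `𝓕` of the continuous subsolutions `w` of the critical system such that
`∫ w_i(x) dμ(x,v,i) ≤ 0` for every Mather measure `μ`. -/
def admissibleSubsolutions {N m : ℕ} (H : Fin m → Torus N → Vec N → ℝ)
    (B : Matrix (Fin m) (Fin m) ℝ) : Set (VecFun N m) :=
  {w | IsSubsolution H B 0 (criticalValue H B) w ∧
    ∀ μ : Measure (Phase N m), IsMatherMeasure H B μ → ∫ z : Phase N m, w z.1 z.2.2 ∂μ ≤ 0}

/-- `u⁰_i(x) = sup {w_i(x) | w ∈ 𝓕}`. -/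
def uZero {N m : ℕ} (H : Fin m → Torus N → Vec N → ℝ) (B : Matrix (Fin m) (Fin m) ℝ)
    (x : Torus N) (i : Fin m) : ℝ :=
  sSup ((fun w : VecFun N m => w x i) '' admissibleSubsolutions H B)

end HJSystem

end

/-!
The argument is the duality between subsolutions and closed measures, at the critical value `c`.

* A subsolution `w` of the `λ`-discounted system is Lipschitz, because its superdifferentials are
  bounded (`le_add_of_superdiff_bounded`), so it satisfies the inequality classically almost
  everywhere. Averaging its translates, with the Fenchel inequality in place of convexity of `H`,
  gives `C¹` functions `φ` with `(Bφ)_i + ⟨Dφ_i, v⟩ ≤ L_i + c - λ w_i + ε`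
  (`IsSubsolution.exists_C1`). Integrating against a closed measure yields
  `λ ∫ w dμ ≤ ∫ L dμ + c` (`IsSubsolution.mul_integral_le`).

* The limit `u` of discounted solutions solves the critical system, by stability. A `C¹` function
  cannot be a strict critical subsolution, since it would contradict the supersolution property of
  `u` at a minimum point of `u_i - φ_i` over all `x` and `i`
  (`IsSupersolution.exists_velocity`). As `u` is Lipschitz, only momenta, and hence only
  velocities, in a bounded set matter here. On the resulting compact set, the Hahn–Banach theorem
  and the Riesz–Markov–Kakutani theorem turn this into a closed measure of action at most `-c`
  (`exists_measure_annihilating`, `exists_closedMeasure`).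

Hence Mather measures exist and have action `-c`. The first inequality for a Mather measure then
reads `λ ∫ u^λ dμ ≤ 0`, and the claim on `u` follows in the limit; in particular, `u` is one of the
functions in the supremum defining `u⁰`. That supremum is finite because every admissible
subsolution is nonpositive somewhere, by the constraint for one Mather measure, while the
oscillation of critical subsolutions over all points and components is bounded
(`exists_oscillation_subsolution_le`). For the latter, `Bw` is bounded above because `H` is bounded
below; irreducibility of `B` then bounds the differences `w_i - w_j`, hence `Bw` on both sides, and
coercivity of `H` gives a common Lipschitz constant.
-/

noncomputable section

namespace HJSystem

/-! ### The projection onto the torus -/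

section Projection

variable {N : ℕ}

lemma proj_zero : proj (0 : Vec N) = 0 := by
  ext j; simp [proj]

lemma proj_add (h k : Vec N) : proj (h + k) = proj h + proj k := by
  ext j; simp [proj]

lemma proj_neg (h : Vec N) : proj (-h) = -proj h := by
  ext j; simp [proj]

lemma proj_sub (h k : Vec N) : proj (h - k) = proj h - proj k := by
  ext j; simp [proj]

@[fun_prop]
lemma continuous_proj : Continuous (proj : Vec N → Torus N) := by
  unfold proj
  refine continuous_pi fun j => ?_
  exact (AddCircle.continuous_mk' (1 : ℝ)).comp (by fun_prop)

/-- Every point of the torus has a representative in the unit cube. -/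
lemma exists_proj_eq (x : Torus N) : ∃ h : Vec N, proj h = x ∧ ‖h‖ ≤ √N := by
  refine ⟨WithLp.toLp 2 fun j => ((AddCircle.equivIco (1 : ℝ) 0 (x j) : Set.Ico (0 : ℝ) (0 + 1)) : ℝ),
    ?_, ?_⟩
  · ext j
    exact AddCircle.coe_equivIco
  · rw [EuclideanSpace.norm_eq]
    refine Real.sqrt_le_sqrt ?_
    calc _ ≤ ∑ _j : Fin N, (1 : ℝ) := by
          refine Finset.sum_le_sum fun j _ => ?_
          have h := (AddCircle.equivIco (1 : ℝ) 0 (x j)).2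
          rw [Set.mem_Ico] at h
          simp only [Real.norm_eq_abs, sq_abs]
          nlinarith [h.1, h.2]
      _ = N := by simp

lemma isOpenMap_proj : IsOpenMap (proj : Vec N → Torus N) := by
  have h : IsOpenMap (Pi.map fun (_ : Fin N) (t : ℝ) => (t : UnitAddCircle)) :=
    IsOpenMap.piMap (fun _ => QuotientAddGroup.isOpenMap_coe)
      (Eventually.of_forall fun _ => QuotientAddGroup.mk_surjective)
  exact h.comp (EuclideanSpace.equiv (Fin N) ℝ).toHomeomorph.isOpenMap

end Projection

/-! ### Superdifferentials and subdifferentials -/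

section Semidifferentials

variable {N : ℕ} {f : Torus N → ℝ} {x : Torus N} {p : Vec N}

lemma mem_subdiff_iff_neg : p ∈ subdiff f x ↔ -p ∈ superdiff (fun y => -f y) x := by
  simp only [subdiff, superdiff, Set.mem_ofPred_eq]
  refine forall₂_congr fun ε _ => eventually_congr (Eventually.of_forall fun h => ?_)
  rw [inner_neg_left]
  constructor <;> intro h <;> linarith

/-- A function touching `f` from above at a point has its gradient in the superdifferential. -/
lemma mem_superdiff_of_isLocalMax {ψ : Vec N → ℝ} {h₀ : Vec N}
    (hψ : HasFDerivAt ψ (innerSL ℝ p) h₀)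
    (hmax : IsLocalMax (fun h => f (x + proj h) - ψ h) h₀) : p ∈ superdiff f (x + proj h₀) := by
  intro ε hε
  have ht : Tendsto (fun h : Vec N => h₀ + h) (𝓝 0) (𝓝 h₀) := by
    have : Continuous fun h : Vec N => h₀ + h := by fun_prop
    simpa using this.tendsto 0
  filter_upwards [ht.eventually (hψ.isLittleO.def hε), ht.eventually hmax] with h h1 h2
  simp only [add_sub_cancel_left, innerSL_apply_apply, Real.norm_eq_abs] at h1
  rw [proj_add, ← add_assoc] at h2
  linarith [(abs_le.1 h1).2]

/-- A function touching `f` from below at a point has its gradient in the subdifferential. -/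
lemma mem_subdiff_of_isLocalMin {ψ : Vec N → ℝ} {h₀ : Vec N}
    (hψ : HasFDerivAt ψ (innerSL ℝ p) h₀)
    (hmin : IsLocalMin (fun h => f (x + proj h) - ψ h) h₀) : p ∈ subdiff f (x + proj h₀) := by
  rw [mem_subdiff_iff_neg]
  refine mem_superdiff_of_isLocalMax (ψ := fun h => -ψ h) 
    (by rw [map_neg]; exact hψ.neg) ?_
  filter_upwards [hmin] with h h1
  linarith

lemma norm_le_of_mem_subdiff {K : ℝ} (hK0 : 0 ≤ K) (hK : ∀ h, f (x + proj h) ≤ f x + K * ‖h‖)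
    (hp : p ∈ subdiff f x) : ‖p‖ ≤ K := by
  refine le_of_forall_pos_le_add fun ε hε => ?_
  rcases eq_or_ne p 0 with rfl | hp0
  · rw [norm_zero]
    positivity
  · have ht : Tendsto (fun t : ℝ => t • p) (𝓝[>] 0) (𝓝 0) := by
      have : Continuous fun t : ℝ => t • p := by fun_prop
      simpa using (this.tendsto 0).mono_left nhdsWithin_le_nhds
    obtain ⟨t, h1, h2⟩ := ((ht.eventually (hp ε hε)).and self_mem_nhdsWithin).exists
    have h2 : 0 < t := h2
    have h3 := hK (t • p)
    have h4 : 0 < ‖p‖ := norm_pos_iff.2 hp0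
    rw [inner_smul_right, real_inner_self_eq_norm_sq] at h1
    rw [norm_smul, Real.norm_of_nonneg h2.le] at h1 h3
    have h5 : (t * ‖p‖) * ‖p‖ ≤ (t * ‖p‖) * (K + ε) := by nlinarith
    exact le_of_mul_le_mul_left h5 (by positivity)

/-- A continuous function all of whose superdifferentials are bounded by `K` is `K`-Lipschitz:
a cone of slope `K' > K` with vertex at `x` cannot touch it from above away from `x`. -/
lemma le_add_of_superdiff_bounded (hf : Continuous f) {K : ℝ} (hK0 : 0 ≤ K)
    (hK : ∀ x, ∀ p ∈ superdiff f x, ‖p‖ ≤ K) (x : Torus N) (h : Vec N) :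
    f (x + proj h) ≤ f x + K * ‖h‖ := by
  have key : ∀ K' > K, f (x + proj h) ≤ f x + K' * ‖h‖ := by
    intro K' hK'
    have hK'0 : 0 < K' := hK0.trans_lt hK'
    have hcont : Continuous fun h : Vec N => f (x + proj h) - K' * ‖h‖ := by fun_prop
    obtain ⟨C, hC⟩ := (isCompact_range hf).bddAbove
    have hlim : Tendsto (fun h : Vec N => f (x + proj h) - K' * ‖h‖) (cocompact _) atBot := by
      refine tendsto_atBot_mono (g := fun h : Vec N => f (x + proj h) - K' * ‖h‖)
        (f := fun h : Vec N => C + -(K' * ‖h‖)) (fun h => ?_) ?_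
      · have := hC (Set.mem_range_self (x + proj h))
        linarith
      · exact tendsto_atBot_add_const_left _ _ (tendsto_neg_atTop_atBot.comp
          ((tendsto_norm_cocompact_atTop (E := Vec N)).const_mul_atTop hK'0))
    obtain ⟨h₀, hh₀⟩ := hcont.exists_forall_ge hlim
    have h0 : h₀ = 0 := by
      by_contra hne
      have hpos : 0 < ‖h₀‖ := norm_pos_iff.2 hne
      have hd : HasFDerivAt (fun h : Vec N => K' * ‖h‖)
          (innerSL ℝ ((K' * ‖h₀‖⁻¹) • h₀)) h₀ := by
        have h1 := (((hasStrictFDerivAt_norm_sq h₀).hasFDerivAt).sqrt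
          (by positivity)).const_mul K'
        have h2 : (fun h : Vec N => K' * √(‖h‖ ^ 2)) = fun h => K' * ‖h‖ := by
          ext h; rw [Real.sqrt_sq (norm_nonneg h)]
        rw [h2] at h1
        refine h1.congr_fderiv (ContinuousLinearMap.ext fun v => ?_)
        simp only [innerSL_apply_apply, inner_smul_left, smul_apply, smul_eq_mul,
          Real.sqrt_sq (norm_nonneg h₀), nsmul_eq_mul]
        simp
        field_simp
      have hp := hK _ _ (mem_superdiff_of_isLocalMax hd (f := f) (x := x)
        (Eventually.of_forall hh₀))
      rw [norm_smul, Real.norm_of_nonneg (by positivity), mul_assoc, inv_mul_cancel₀ hpos.ne',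
        mul_one] at hp
      linarith
    have h1 := hh₀ h
    rw [h0, proj_zero, add_zero, norm_zero, mul_zero, sub_zero] at h1
    linarith
  refine le_of_forall_pos_le_add fun ε hε => ?_
  have hh : 0 < ‖h‖ + 1 := by positivity
  have h1 := key (K + ε / (‖h‖ + 1)) (by have := div_pos hε hh; linarith)
  have h2 : ε / (‖h‖ + 1) * ‖h‖ ≤ ε := by
    rw [div_mul_eq_mul_div, div_le_iff₀ hh]
    nlinarith
  nlinarith

/-- Superdifferentials are stable under uniform approximation: near an element of `D⁺f(x)` there
are elements of the superdifferentials of all functions uniformly close to `f`. They are found by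
touching with a paraboloid steep enough to localize the maximum. -/
lemma exists_superdiff_near (hp : p ∈ superdiff f x) {ε : ℝ} (hε : 0 < ε) :
    ∃ δ > 0, ∀ g : Torus N → ℝ, Continuous g → (∀ y, |g y - f y| ≤ δ) →
      ∃ (h q : Vec N), q ∈ superdiff g (x + proj h) ∧ ‖h‖ ≤ ε ∧ ‖q - p‖ ≤ ε := by
  obtain ⟨r₀, hr₀, hr⟩ := Metric.eventually_nhds_iff_ball.1 (hp (ε / 4) (by positivity))
  set r := min (r₀ / 2) ε with hrdef
  have hrpos : 0 < r := by positivity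
  have hrε : r ≤ ε := min_le_right _ _
  have hrr : r < r₀ := (min_le_left _ _).trans_lt (by linarith)
  refine ⟨ε * r / 16, by positivity, fun g hg hgf => ?_⟩
  set a := ε / (2 * r) with ha
  have har : a * r = ε / 2 := by rw [ha]; field_simp
  have hapos : 0 < a := by positivity
  let ψ : Vec N → ℝ := fun h => inner ℝ p h + a * ‖h‖ ^ 2
  have hψc : Continuous ψ := by fun_prop
  obtain ⟨h₀, hmem, hmax⟩ := (isCompact_closedBall (0 : Vec N) r).exists_isMaxOn
    ⟨0, by simp [hrpos.le]⟩
    (f := fun h => g (x + proj h) - ψ h) (by fun_prop)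
  have hlt : ‖h₀‖ < r := by
    by_contra hge
    have hle : ‖h₀‖ ≤ r := by simpa using hmem
    have heq : ‖h₀‖ = r := le_antisymm hle (not_lt.1 hge)
    have h1 := hr h₀ (by simpa [heq] using hrr)
    have h2 : g (x + proj 0) - ψ 0 ≤ g (x + proj h₀) - ψ h₀ := hmax (by simp [hrpos.le])
    simp only [ψ, proj_zero, add_zero, inner_zero_right, norm_zero, heq] at h2
    have h3 := (abs_le.1 (hgf x)).1
    have h4 := (abs_le.1 (hgf (x + proj h₀))).2
    rw [heq] at h1
    have h5 : a * r ^ 2 = ε / 2 * r := by rw [sq, ← mul_assoc, har]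
    nlinarith [mul_pos hε hrpos]
  refine ⟨h₀, p + (2 * a) • h₀, mem_superdiff_of_isLocalMax (ψ := ψ) ?_ ?_, hlt.le.trans hrε, ?_⟩
  · have h1 := (innerSL ℝ p).hasFDerivAt (x := h₀) |>.add
      (((hasStrictFDerivAt_norm_sq h₀).hasFDerivAt).const_mul a)
    refine h1.congr_fderiv (ContinuousLinearMap.ext fun v => ?_)
    simp
    ring
  · exact hmax.isLocalMax (Metric.closedBall_mem_nhds_of_mem (by simpa using hlt))
  · rw [add_sub_cancel_left, norm_smul, Real.norm_of_nonneg (by positivity)]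
    nlinarith

lemma exists_subdiff_near (hp : p ∈ subdiff f x) {ε : ℝ} (hε : 0 < ε) :
    ∃ δ > 0, ∀ g : Torus N → ℝ, Continuous g → (∀ y, |g y - f y| ≤ δ) →
      ∃ (h q : Vec N), q ∈ subdiff g (x + proj h) ∧ ‖h‖ ≤ ε ∧ ‖q - p‖ ≤ ε := by
  obtain ⟨δ, hδ, H⟩ := exists_superdiff_near (mem_subdiff_iff_neg.1 hp) hε
  refine ⟨δ, hδ, fun g hg hgf => ?_⟩
  obtain ⟨h, q, hq, hh, hqp⟩ := H (fun y => -g y) hg.neg fun y => by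
    rw [neg_sub_neg, abs_sub_comm]; exact hgf y
  refine ⟨h, -q, mem_subdiff_iff_neg.2 (by rwa [neg_neg]), hh, ?_⟩
  rwa [← norm_neg, show -(-q - p) = q - -p by abel]

end Semidifferentials

/-! ### Stability of viscosity solutions -/

section Stability

variable {N m : ℕ} {H : Fin m → Torus N → Vec N → ℝ} {B : Matrix (Fin m) (Fin m) ℝ} {c : ℝ}
  {lam : ℕ → ℝ} {v : ℕ → VecFun N m} {u : VecFun N m}

lemma mulVec_add_smul_one (B : Matrix (Fin m) (Fin m) ℝ) (l : ℝ) (a : Fin m → ℝ) (i : Fin m) :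
    ((B + l • (1 : Matrix (Fin m) (Fin m) ℝ)) *ᵥ a) i = (B *ᵥ a) i + l * a i := by
  simp [Matrix.add_mulVec, Matrix.smul_mulVec]

/-- If elements of semidifferentials of functions close to `u_i` can be found near `(x, p)`, then
the value of the critical operator at `(x, p, u)` is a limit of values of the discounted operators
at elements of the semidifferentials `D` of the approximating functions. -/
lemma exists_seq_tendsto_operator (hH : HamiltonianAssumptions H)
    (hlam : Tendsto lam atTop (𝓝 0)) (hv : Tendsto v atTop (𝓝 u))
    {D : (Torus N → ℝ) → Torus N → Set (Vec N)} {x : Torus N} {i : Fin m} {p : Vec N}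
    (hD : ∀ ε > 0, ∃ δ > 0, ∀ g : Torus N → ℝ, Continuous g → (∀ y, |g y - u y i| ≤ δ) →
      ∃ (h q : Vec N), q ∈ D g (x + proj h) ∧ ‖h‖ ≤ ε ∧ ‖q - p‖ ≤ ε) :
    ∃ (k : ℕ → ℕ) (y : ℕ → Torus N) (q : ℕ → Vec N),
      (∀ n, q n ∈ D (fun z => v (k n) z i) (y n)) ∧
      Tendsto (fun n => H i (y n) (q n) +
        ((B + lam (k n) • (1 : Matrix (Fin m) (Fin m) ℝ)) *ᵥ v (k n) (y n)) i) atTop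
        (𝓝 (H i x p + ((B + (0 : ℝ) • (1 : Matrix (Fin m) (Fin m) ℝ)) *ᵥ u x) i)) := by
  have hex : ∀ n : ℕ, ∃ (k : ℕ) (h q : Vec N), n ≤ k ∧ q ∈ D (fun z => v k z i) (x + proj h) ∧
      ‖h‖ ≤ 1 / ((n : ℝ) + 1) ∧ ‖q - p‖ ≤ 1 / ((n : ℝ) + 1) := by
    intro n
    obtain ⟨δ, hδ, H1⟩ := hD (1 / ((n : ℝ) + 1)) (by positivity)
    obtain ⟨k, hk1, hk2⟩ := ((Metric.tendsto_nhds.1 hv δ hδ).and (eventually_ge_atTop n)).exists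
    obtain ⟨h, q, h1, h2, h3⟩ := H1 (fun z => v k z i) (by fun_prop) fun y => by
      rw [← Real.dist_eq]
      exact (dist_le_pi_dist _ _ i).trans ((ContinuousMap.dist_apply_le_dist y).trans hk1.le)
    exact ⟨k, h, q, hk2, h1, h2, h3⟩
  choose k h q hk hq hh hqp using hex
  refine ⟨k, fun n => x + proj (h n), q, hq, ?_⟩
  have h0 : Tendsto h atTop (𝓝 0) :=
    squeeze_zero_norm hh tendsto_one_div_add_atTop_nhds_zero_nat
  have hy : Tendsto (fun n => x + proj (h n)) atTop (𝓝 x) := by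
    have := (continuous_proj (N := N)).tendsto 0
    rw [proj_zero] at this
    simpa using (this.comp h0).const_add x
  have hqlim : Tendsto q atTop (𝓝 p) := by
    rw [tendsto_iff_norm_sub_tendsto_zero]
    exact squeeze_zero (fun _ => norm_nonneg _) hqp tendsto_one_div_add_atTop_nhds_zero_nat
  have hklim : Tendsto k atTop atTop := tendsto_atTop_mono hk tendsto_id
  have hvy : Tendsto (fun n => v (k n) (x + proj (h n))) atTop (𝓝 (u x)) := by
    have : Continuous fun z : VecFun N m × Torus N => z.1 z.2 := by fun_prop
    have h2 := (hv.comp hklim).prodMk_nhds hy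
    exact (this.tendsto (u, x)).comp h2
  refine Tendsto.add ?_ ?_
  · exact ((hH.continuous i).tendsto (x, p)).comp (hy.prodMk_nhds hqlim)
  · simp only [mulVec_add_smul_one]
    have hB : Continuous fun a : Fin m → ℝ => (B *ᵥ a) i := by fun_prop
    exact ((hB.tendsto (u x)).comp hvy).add
      ((hlam.comp hklim).mul (((continuous_apply i).tendsto (u x)).comp hvy))

lemma IsSubsolution.of_tendsto (hH : HamiltonianAssumptions H)
    (hlam : Tendsto lam atTop (𝓝 0)) (hv : Tendsto v atTop (𝓝 u))
    (hsub : ∀ k, IsSubsolution H B (lam k) c (v k)) : IsSubsolution H B 0 c u := by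
  intro x i p hp
  obtain ⟨k, y, q, hq, hlim⟩ := exists_seq_tendsto_operator (B := B) hH hlam hv (D := superdiff)
    (fun ε hε => exists_superdiff_near hp hε)
  exact le_of_tendsto' hlim fun n => hsub _ _ _ _ (hq n)

lemma IsSupersolution.of_tendsto (hH : HamiltonianAssumptions H)
    (hlam : Tendsto lam atTop (𝓝 0)) (hv : Tendsto v atTop (𝓝 u))
    (hsup : ∀ k, IsSupersolution H B (lam k) c (v k)) : IsSupersolution H B 0 c u := by
  intro x i p hp
  obtain ⟨k, y, q, hq, hlim⟩ := exists_seq_tendsto_operator (B := B) hH hlam hv (D := subdiff)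
    (fun ε hε => exists_subdiff_near hp hε)
  exact ge_of_tendsto' hlim fun n => hsup _ _ _ _ (hq n)

end Stability

/-! ### The Lagrangian -/

/-- Continuity on `TM × {1,…,m}` may be checked for each index separately. -/
lemma continuous_phase {N m : ℕ} {F : Fin m → Torus N → Vec N → ℝ}
    (hF : ∀ i, Continuous fun z : Torus N × Vec N => F i z.1 z.2) :
    Continuous fun z : Phase N m => F z.2.2 z.1 z.2.1 := by
  rw [continuous_iff_continuousAt]
  rintro ⟨x, v, i⟩
  have h1 : ContinuousAt (fun z : Phase N m => F i z.1 z.2.1) (x, v, i) :=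
    ((hF i).comp (f := fun z : Phase N m => (z.1, z.2.1)) (by fun_prop)).continuousAt
  refine h1.congr ?_
  have h2 : ∀ᶠ z : Phase N m in 𝓝 (x, v, i), z.2.2 = i := by
    have : Continuous fun z : Phase N m => z.2.2 := by fun_prop
    exact this.continuousAt.eventually (p := fun j => j = i) (by simp [nhds_discrete])
  filter_upwards [h2] with z hz
  rw [hz]

section Lagrangian

variable {N m : ℕ} {H : Fin m → Torus N → Vec N → ℝ}

lemma exists_abs_hamiltonian_le (hH : HamiltonianAssumptions H) (K : ℝ) :
    ∃ M, 0 ≤ M ∧ ∀ i x p, ‖p‖ ≤ K → |H i x p| ≤ M := by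
  have h1 : ∀ i, ∃ M, ∀ z ∈ (Set.univ : Set (Torus N)) ×ˢ Metric.closedBall (0 : Vec N) K,
      ‖H i z.1 z.2‖ ≤ M := fun i =>
    (isCompact_univ.prod (isCompact_closedBall (0 : Vec N) K)).exists_bound_of_continuousOn
      (hH.continuous i).continuousOn
  choose M hM using h1
  obtain ⟨C, hC⟩ := (Set.finite_range M).bddAbove
  refine ⟨max C 0, le_max_right _ _, fun i x p hp => le_max_of_le_left ?_⟩
  exact (hM i (x, p) ⟨trivial, by simpa using hp⟩).trans (hC ⟨i, rfl⟩)

/-- Superlinearity, uniformly in the base point: `H` grows faster than any multiple of `|p|`. -/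
lemma exists_le_hamiltonian (hH : HamiltonianAssumptions H) (k : ℝ) :
    ∃ C, ∀ i x p, k * ‖p‖ - C ≤ H i x p := by
  have h1 : ∀ i, ∃ C, ∀ x p, k * ‖p‖ - C ≤ H i x p := by
    intro i
    obtain ⟨α, β, hα, -, hαβ⟩ := hH.superlinear i
    obtain ⟨A, hA⟩ := eventually_atTop.1
      ((hα.eventually (eventually_ge_atTop k)).and (eventually_gt_atTop 0))
    obtain ⟨M, hM0, hM⟩ := exists_abs_hamiltonian_le hH A
    refine ⟨|k| * |A| + M, fun x p => ?_⟩
    rcases le_total ‖p‖ A with hp | hp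
    · have h2 := (abs_le.1 (hM i x p hp)).1
      have h3 : k * ‖p‖ ≤ |k| * |A| := mul_le_mul (le_abs_self k) (hp.trans (le_abs_self A))
        (norm_nonneg _) (abs_nonneg _)
      linarith
    · obtain ⟨h2, h3⟩ := hA _ hp
      rw [le_div_iff₀ h3] at h2
      have := (hαβ x p).1
      have := mul_nonneg (abs_nonneg k) (abs_nonneg A)
      linarith
  choose C hC using h1
  obtain ⟨D, hD⟩ := (Set.finite_range C).bddAbove
  refine ⟨D, fun i x p => ?_⟩
  have : C i ≤ D := hD ⟨i, rfl⟩
  linarith [hC i x p]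

lemma bddAbove_lagrangian (hH : HamiltonianAssumptions H) (i : Fin m) (x : Torus N) (v : Vec N) :
    BddAbove (Set.range fun p : Vec N => (inner ℝ p v - H i x p : ℝ)) := by
  obtain ⟨C, hC⟩ := exists_le_hamiltonian hH ‖v‖
  refine ⟨C, ?_⟩
  rintro _ ⟨p, rfl⟩
  have := real_inner_le_norm p v
  have := hC i x p
  simp only
  linarith [mul_comm ‖p‖ ‖v‖]

/-- The Fenchel inequality. -/
lemma inner_le_lagrangian_add (hH : HamiltonianAssumptions H) (i : Fin m) (x : Torus N)
    (p v : Vec N) : inner ℝ p v ≤ lagrangian H i x v + H i x p := by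
  have : inner ℝ p v - H i x p ≤ lagrangian H i x v :=
    le_ciSup (bddAbove_lagrangian hH i x v) p
  linarith

/-- The Lagrangian is continuous: for bounded velocities, the supremum defining it may be taken
over a fixed ball of momenta. -/
lemma continuous_lagrangian (hH : HamiltonianAssumptions H) :
    Continuous fun z : Phase N m => lagrangian H z.2.2 z.1 z.2.1 := by
  have key : ∀ i, Continuous fun z : Torus N × Vec N => lagrangian H i z.1 z.2 := by
    intro i
    rw [continuous_iff_continuousAt]
    rintro ⟨x₀, v₀⟩
    obtain ⟨C, hC⟩ := exists_le_hamiltonian hH (‖v₀‖ + 2)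
    obtain ⟨M, hM0, hM⟩ := exists_abs_hamiltonian_le hH 0
    set A := max (C + M) 0
    have hA0 : 0 ≤ A := le_max_right _ _
    have hsup : Continuous fun z : Torus N × Vec N =>
        sSup ((fun p : Vec N => (inner ℝ p z.2 - H i z.1 p : ℝ)) '' Metric.closedBall 0 A) := by
      refine (isCompact_closedBall (0 : Vec N) A).continuous_sSup
        (f := fun (z : Torus N × Vec N) (p : Vec N) => (inner ℝ p z.2 - H i z.1 p : ℝ)) ?_
      have h1 := (hH.continuous i).comp
        (f := fun w : (Torus N × Vec N) × Vec N => (w.1.1, w.2)) (by fun_prop)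
      have h2 : Continuous fun w : (Torus N × Vec N) × Vec N => (inner ℝ w.2 w.1.2 : ℝ) := by
        fun_prop
      exact h2.sub h1
    refine hsup.continuousAt.congr ?_
    have hnear : ∀ᶠ z : Torus N × Vec N in 𝓝 (x₀, v₀), ‖z.2‖ < ‖v₀‖ + 1 := by
      have : Continuous fun z : Torus N × Vec N => ‖z.2‖ := by fun_prop
      exact this.continuousAt.eventually_lt continuousAt_const (by simp)
    filter_upwards [hnear] with z hz
    have hbdd := bddAbove_lagrangian hH i z.1 z.2
    have hbdd' : BddAbove ((fun p : Vec N => (inner ℝ p z.2 - H i z.1 p : ℝ)) ''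
        Metric.closedBall 0 A) := hbdd.mono (Set.image_subset_range _ _)
    refine le_antisymm (csSup_le_csSup hbdd ((Metric.nonempty_closedBall.2 hA0).image _)
      (Set.image_subset_range _ _)) (ciSup_le fun p => ?_)
    by_cases hp : ‖p‖ ≤ A
    · exact le_csSup hbdd' ⟨p, by simpa using hp, rfl⟩
    · -- outside the ball, the competitor is worse than the zero momentum
      push Not at hp
      refine le_trans ?_ (le_csSup hbdd' ⟨0, by simpa using hA0, rfl⟩)
      have h1 := real_inner_le_norm p z.2
      have h2 := hC i z.1 p
      have h3 := (abs_le.1 (hM i z.1 0 (by simp))).2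
      have h4 : C + M < ‖p‖ := (le_max_left _ _).trans_lt hp
      have h5 : ‖p‖ * ‖z.2‖ ≤ ‖p‖ * (‖v₀‖ + 1) :=
        mul_le_mul_of_nonneg_left hz.le (norm_nonneg _)
      simp only [inner_zero_left]
      nlinarith
  exact continuous_phase key

/-- Momenta in a bounded set are almost dual to velocities in a bounded set: the Fenchel
inequality is almost an equality at an approximate subgradient of `H_i(x,·)` at `p`, which is
bounded by the oscillation of `H` on a neighbouring ball. -/
lemma exists_velocity (hH : HamiltonianAssumptions H) (K : ℝ) :
    ∃ R, ∀ i x p, ‖p‖ ≤ K → ∀ ε > 0, ε ≤ 1 →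
      ∃ v : Vec N, ‖v‖ ≤ R ∧ lagrangian H i x v ≤ inner ℝ p v - H i x p + ε := by
  obtain ⟨M, hM0, hM⟩ := exists_abs_hamiltonian_le hH (K + 1)
  refine ⟨2 * M + 1, fun i x p hp ε hε hε1 => ?_⟩
  have hc : Continuous (H i x) :=
    (hH.continuous i).comp (f := fun q : Vec N => (x, q)) (by fun_prop)
  obtain ⟨l, a, hla, hlp⟩ := (hH.convex i x).exists_affine_le_of_lt (𝕜 := ℝ) (x := p)
    (a := H i x p - ε) (Set.mem_univ p) (by linarith) isClosed_univ
    (hc.lowerSemicontinuous.lowerSemicontinuousOn _)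
  set v := (InnerProductSpace.toDual ℝ (Vec N)).symm l with hv
  have hlv : ∀ q, l q = inner ℝ q v := fun q => by
    rw [real_inner_comm, hv, InnerProductSpace.toDual_symm_apply]
  have hsub : ∀ q, inner ℝ q v + a ≤ H i x q := fun q => by
    have := hla ⟨q, trivial⟩
    simpa [hlv] using this
  have heq : inner ℝ p v + a = H i x p - ε := by simpa [hlv] using hlp
  refine ⟨v, ?_, ciSup_le fun q => by linarith [hsub q]⟩
  rcases eq_or_ne v 0 with h0 | h0
  · rw [h0, norm_zero]; positivity
  · have hvpos : 0 < ‖v‖ := norm_pos_iff.2 h0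
    have h1 := hsub (p + ‖v‖⁻¹ • v)
    have hn : ‖‖v‖⁻¹ • v‖ = 1 := by
      rw [norm_smul, norm_inv, norm_norm, inv_mul_cancel₀ hvpos.ne']
    rw [inner_add_left, real_inner_smul_left, real_inner_self_eq_norm_sq,
      show ‖v‖⁻¹ * ‖v‖ ^ 2 = ‖v‖ by field_simp] at h1
    have h2 := (abs_le.1 (hM i x (p + ‖v‖⁻¹ • v) ((norm_add_le _ _).trans (by linarith)))).2
    have h3 := (abs_le.1 (hM i x p (by linarith))).1
    linarith

end Lagrangian

/-! ### Lipschitz estimates for subsolutions -/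

section Lipschitz

variable {N m : ℕ} {H : Fin m → Torus N → Vec N → ℝ} {B : Matrix (Fin m) (Fin m) ℝ} {lam c : ℝ}

/-- The components of a subsolution with a lower bound on the zeroth order terms are Lipschitz,
with a constant depending on this bound only. -/
lemma exists_lipschitz_of_subsolution (hH : HamiltonianAssumptions H) (c C : ℝ) :
    ∃ K, 0 ≤ K ∧ ∀ (lam : ℝ) (w : VecFun N m), IsSubsolution H B lam c w →
      (∀ x i, -C ≤ ((B + lam • (1 : Matrix (Fin m) (Fin m) ℝ)) *ᵥ w x) i) →
      ∀ i x h, w (x + proj h) i ≤ w x i + K * ‖h‖ := by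
  obtain ⟨D, hD⟩ := exists_le_hamiltonian hH 1
  refine ⟨max (c + C + D) 0, le_max_right _ _, fun lam w hw hC i x h => ?_⟩
  refine le_add_of_superdiff_bounded (f := fun y => w y i) (by fun_prop) (le_max_right _ _)
    (fun y p hp => le_max_of_le_left ?_) x h
  linarith [hw y i p hp, hC y i, hD i y p]

lemma IsSubsolution.exists_lipschitz (hH : HamiltonianAssumptions H) {w : VecFun N m}
    (hw : IsSubsolution H B lam c w) :
    ∃ K, 0 ≤ K ∧ ∀ i x h, w (x + proj h) i ≤ w x i + K * ‖h‖ := by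
  have hcont : Continuous fun x => (B + lam • (1 : Matrix (Fin m) (Fin m) ℝ)) *ᵥ w x := by
    fun_prop
  obtain ⟨C, hC⟩ := (isCompact_range hcont).isBounded.exists_norm_le
  obtain ⟨K, hK0, hK⟩ := exists_lipschitz_of_subsolution (B := B) hH c C
  refine ⟨K, hK0, hK lam w hw fun x i => ?_⟩
  have h1 := hC _ ⟨x, rfl⟩
  exact (abs_le.1 ((norm_le_pi_norm _ i).trans h1)).1

/-- Lipschitz bound for the lift of a function to the universal cover, centred at `x`. -/
lemma lipschitzWith_lift {f : Torus N → ℝ} {K : ℝ} (hK0 : 0 ≤ K)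
    (hK : ∀ x h, f (x + proj h) ≤ f x + K * ‖h‖) (x : Torus N) :
    LipschitzWith K.toNNReal fun h : Vec N => f (x + proj h) := by
  refine LipschitzWith.of_le_add_mul _ fun h k => ?_
  have h1 := hK (x + proj k) (h - k)
  rw [add_assoc, ← proj_add, add_sub_cancel] at h1
  rwa [Real.coe_toNNReal _ hK0, dist_eq_norm]

lemma mem_superdiff_of_hasFDerivAt {f : Torus N → ℝ} {x : Torus N} {p h : Vec N}
    (hf : HasFDerivAt (fun h : Vec N => f (x + proj h)) (innerSL ℝ p) h) :
    p ∈ superdiff f (x + proj h) :=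
  mem_superdiff_of_isLocalMax hf (Eventually.of_forall fun k => by simp)

end Lipschitz

/-! ### Functions of class `C¹` on the torus -/

section C1

variable {N : ℕ} {f : Torus N → ℝ}

lemma isQuotientMap_proj : IsQuotientMap (proj : Vec N → Torus N) :=
  isOpenMap_proj.isQuotientMap continuous_proj fun x => (exists_proj_eq x).imp fun _ h => h.1

lemma IsC1.continuous (hf : IsC1 f) : Continuous f :=
  isQuotientMap_proj.continuous_iff.2 (ContDiff.continuous hf)

lemma IsC1.differentiableAt (hf : IsC1 f) (x : Torus N) :
    DifferentiableAt ℝ (fun h : Vec N => f (x + proj h)) 0 := by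
  obtain ⟨y, rfl, -⟩ := exists_proj_eq x
  have h1 : ContDiff ℝ 1 fun h : Vec N => f (proj (y + h)) :=
    ContDiff.comp (g := fun y : Vec N => f (proj y)) hf (contDiff_const.add contDiff_id)
  simp only [proj_add] at h1
  exact (h1.differentiable one_ne_zero) 0

lemma dirDeriv_proj (y : Vec N) : dirDeriv f (proj y) = fderiv ℝ (fun h : Vec N => f (proj h)) y := by
  have := fderiv_comp_add_left (𝕜 := ℝ) (f := fun h : Vec N => f (proj h)) (x := 0) y
  simp only [proj_add, add_zero] at this
  ext v
  rw [dirDeriv, this]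

lemma IsC1.continuous_dirDeriv (hf : IsC1 f) :
    Continuous fun z : Torus N × Vec N => dirDeriv f z.1 z.2 := by
  have hq : IsQuotientMap (Prod.map (proj : Vec N → Torus N) (id : Vec N → Vec N)) :=
    (isOpenMap_proj.prodMap IsOpenMap.id).isQuotientMap (continuous_proj.prodMap continuous_id)
      (isQuotientMap_proj.surjective.prodMap Function.surjective_id)
  refine hq.continuous_iff.2 ?_
  have h1 : Continuous fun z : Vec N × Vec N => fderiv ℝ (fun h : Vec N => f (proj h)) z.1 z.2 :=
    ((ContDiff.continuous_fderiv hf one_ne_zero).comp continuous_fst).clm_apply continuous_snd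
  convert h1 using 2 with z
  simp [dirDeriv_proj]

lemma IsC1.exists_abs_dirDeriv_le (hf : IsC1 f) : ∃ C, 0 ≤ C ∧ ∀ x v, |dirDeriv f x v| ≤ C * ‖v‖ := by
  obtain ⟨C, hC⟩ := ((isCompact_univ (X := Torus N)).prod
    (isCompact_closedBall (0 : Vec N) 1)).exists_bound_of_continuousOn
      hf.continuous_dirDeriv.continuousOn
  refine ⟨max C 0, le_max_right _ _, fun x v => ?_⟩
  refine ContinuousLinearMap.le_of_opNorm_le (fderiv ℝ (fun h : Vec N => f (x + proj h)) 0)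
    (ContinuousLinearMap.opNorm_le_of_unit_norm (le_max_right _ _) fun v hv =>
      le_max_of_le_left (hC (x, v) ⟨trivial, by simp [hv]⟩)) v

end C1

/-! ### Regularization of subsolutions -/

section Mollification

variable {N m : ℕ} {H : Fin m → Torus N → Vec N → ℝ} {B : Matrix (Fin m) (Fin m) ℝ} {lam c : ℝ}

/-- The average of the translates of `f` with weight `ρ`. -/
def mollify (ρ : Vec N → ℝ) (f : Torus N → ℝ) (x : Torus N) : ℝ :=
  ∫ t : Vec N, ρ t * f (x - proj t)

lemma isC1_mollify {ρ : Vec N → ℝ} (hρ : ContDiff ℝ 1 ρ) (hρc : HasCompactSupport ρ)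
    {f : Torus N → ℝ} (hf : Continuous f) : IsC1 (mollify ρ f) := by
  have h1 := HasCompactSupport.contDiff_convolution_left (μ := volume) (n := 1)
    (ContinuousLinearMap.lsmul ℝ ℝ) hρc hρ
    (g := fun y : Vec N => f (proj y)) (by
      have : Continuous fun y : Vec N => f (proj y) := by fun_prop
      exact this.locallyIntegrable)
  have h2 : (fun y : Vec N => mollify ρ f (proj y)) =
      convolution ρ (fun y : Vec N => f (proj y)) (ContinuousLinearMap.lsmul ℝ ℝ) volume := by
    ext y
    simp [mollify, convolution, proj_sub]
  rw [IsC1, h2]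
  exact_mod_cast h1

lemma integrable_mollify {ρ : Vec N → ℝ} (hρ : Continuous ρ) (hρc : HasCompactSupport ρ)
    {f : Torus N → ℝ} (hf : Continuous f) (x : Torus N) :
    Integrable fun t : Vec N => ρ t * f (x - proj t) :=
  Continuous.integrable_of_hasCompactSupport (by fun_prop) hρc.mul_right

lemma ae_differentiableAt_neg {g : Vec N → ℝ} {K : NNReal} (hg : LipschitzWith K g) :
    ∀ᵐ t : Vec N, DifferentiableAt ℝ g (-t) :=
  (Measure.measurePreserving_neg (volume : Measure (Vec N))).quasiMeasurePreserving.ae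
    hg.ae_differentiableAt

/-- The derivative of the average of the translates of a Lipschitz function is the average of its
derivatives, which exist almost everywhere by Rademacher's theorem. -/
lemma dirDeriv_mollify {ρ : Vec N → ℝ} (hρ : Continuous ρ) (hρc : HasCompactSupport ρ)
    (hρ0 : ∀ t, 0 ≤ ρ t) {f : Torus N → ℝ} (hf : Continuous f) {K : ℝ} (hK0 : 0 ≤ K)
    (hK : ∀ x h, f (x + proj h) ≤ f x + K * ‖h‖) (x : Torus N) (v : Vec N) :
    Integrable (fun t : Vec N => ρ t * fderiv ℝ (fun h : Vec N => f (x + proj h)) (-t) v) ∧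
    dirDeriv (mollify ρ f) x v =
      ∫ t : Vec N, ρ t * fderiv ℝ (fun h : Vec N => f (x + proj h)) (-t) v := by
  set g : Vec N → ℝ := fun h => f (x + proj h) with hg
  have hgl : LipschitzWith K.toNNReal g := lipschitzWith_lift hK0 hK x
  have hint := hρ.integrable_of_hasCompactSupport hρc (μ := volume)
  have hF : ∀ h : Vec N, Integrable fun t : Vec N => ρ t * g (h - t) := fun h => by
    have := integrable_mollify hρ hρc hf (x + proj h)
    simpa only [hg, proj_sub, add_sub_assoc] using this
  obtain ⟨h1, h2⟩ := hasFDerivAt_integral_of_dominated_loc_of_lip (μ := volume) (𝕜 := ℝ)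
    (F := fun (h t : Vec N) => ρ t * g (h - t)) (x₀ := 0)
    (F' := fun t => ρ t • fderiv ℝ g (-t)) (bound := fun t => ρ t * K) (s := Set.univ)
    univ_mem (Eventually.of_forall fun h => (hF h).aestronglyMeasurable) (hF 0)
    (by
      refine AEStronglyMeasurable.smul hρ.aestronglyMeasurable ?_
      exact ((measurable_fderiv ℝ g).comp measurable_neg).aestronglyMeasurable)
    (Eventually.of_forall fun t => by
      refine LipschitzWith.lipschitzOnWith (LipschitzWith.of_dist_le_mul fun h k => ?_)
      have h3 := hgl.dist_le_mul (h - t) (k - t)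
      rw [dist_sub_right, Real.coe_toNNReal _ hK0] at h3
      rw [Real.coe_nnabs, abs_of_nonneg (mul_nonneg (hρ0 t) hK0), Real.dist_eq, ← mul_sub, abs_mul,
        abs_of_nonneg (hρ0 t), mul_assoc, ← Real.dist_eq]
      exact mul_le_mul_of_nonneg_left h3 (hρ0 t))
    (hint.mul_const K)
    (by
      filter_upwards [ae_differentiableAt_neg hgl] with t ht
      have h3 : HasFDerivAt (fun h : Vec N => g (h - t)) (fderiv ℝ g (-t)) 0 := by
        refine (hasFDerivAt_comp_sub t).2 ?_
        simpa using ht.hasFDerivAt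
      exact h3.const_mul (ρ t))
  have h4 : (fun h : Vec N => mollify ρ f (x + proj h)) = fun h => ∫ t, ρ t * g (h - t) := by
    ext h
    simp only [mollify, hg, proj_sub, add_sub_assoc]
  refine ⟨by simpa using h1.apply_continuousLinearMap v, ?_⟩
  rw [dirDeriv, h4, h2.fderiv, ContinuousLinearMap.integral_apply h1]
  simp

/-- The average of the translates of a subsolution is an approximate subsolution of class `C¹`,
written in dual form. At almost every translate the subsolution inequality holds in the classical
sense; the Fenchel inequality makes it affine in the gradient, so that it can be averaged. -/
lemma IsSubsolution.exists_C1 (hH : HamiltonianAssumptions H) {w : VecFun N m}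
    (hw : IsSubsolution H B lam c w) {ε : ℝ} (hε : 0 < ε) :
    ∃ φ : Torus N → Fin m → ℝ, (∀ i, IsC1 fun x => φ x i) ∧
      ∀ x v i, (B *ᵥ φ x) i + dirDeriv (fun y => φ y i) x v
        ≤ lagrangian H i x v + c - lam * w x i + ε := by
  obtain ⟨K, hK0, hK⟩ := hw.exists_lipschitz hH
  have hnear : ∀ᶠ t : Vec N in 𝓝 0, ∀ z ∈ (Set.univ : Set (Torus N)) ×ˢ Metric.closedBall (0 : Vec N) K,
      ∀ i, H i z.1 z.2 + lam * w z.1 i < H i (z.1 - proj t) z.2 + lam * w (z.1 - proj t) i + ε := by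
    refine (isCompact_univ.prod (isCompact_closedBall _ _)).eventually_forall_of_forall_eventually
      fun z _ => eventually_all.2 fun i => ?_
    have h1 : Continuous fun y : Vec N × (Torus N × Vec N) => H i y.2.1 y.2.2 + lam * w y.2.1 i :=
      ((hH.continuous i).comp continuous_snd).add (by fun_prop)
    have h2 : Continuous fun y : Vec N × (Torus N × Vec N) =>
        H i (y.2.1 - proj y.1) y.2.2 + lam * w (y.2.1 - proj y.1) i + ε :=
      (((hH.continuous i).comp (f := fun y : Vec N × (Torus N × Vec N) =>
        (y.2.1 - proj y.1, y.2.2)) (by fun_prop)).add (by fun_prop)).add continuous_const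
    refine h1.continuousAt.eventually_lt h2.continuousAt ?_
    simp [proj_zero, hε]
  obtain ⟨δ, hδ, hball⟩ := Metric.eventually_nhds_iff_ball.1 hnear
  let b : ContDiffBump (0 : Vec N) := ⟨δ / 2, δ, by positivity, by linarith⟩
  set ρ : Vec N → ℝ := b.normed volume with hρdef
  have hρ : ContDiff ℝ 1 ρ := b.contDiff_normed
  have hρcont : Continuous ρ := hρ.continuous
  have hρc : HasCompactSupport ρ := b.hasCompactSupport_normed
  have hρ0 : ∀ t, 0 ≤ ρ t := fun t => b.nonneg_normed t
  have hρ1 : ∫ t, ρ t = 1 := b.integral_normed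
  have hwc : ∀ i, Continuous fun y => w y i := fun i => by fun_prop
  refine ⟨fun x i => mollify ρ (fun y => w y i) x, fun i => isC1_mollify hρ hρc (hwc i),
    fun x v i => ?_⟩
  obtain ⟨hI, hD⟩ := dirDeriv_mollify hρcont hρc hρ0 (hwc i) hK0 (hK i) x v
  set g : Vec N → ℝ := fun h => w (x + proj h) i with hg
  have hgl : LipschitzWith K.toNNReal g := lipschitzWith_lift (f := fun y => w y i) hK0 (hK i) x
  have hBeq : (B *ᵥ fun j => mollify ρ (fun y => w y j) x) i =
      ∫ t, ρ t * (B *ᵥ w (x - proj t)) i := by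
    simp only [Matrix.mulVec, dotProduct, mollify, Finset.mul_sum]
    rw [integral_finsetSum]
    · refine Finset.sum_congr rfl fun j _ => ?_
      rw [← integral_const_mul]
      congr 1 with t
      ring
    · intro j _
      have := (integrable_mollify hρcont hρc (hwc j) x).const_mul (B i j)
      refine this.congr (Eventually.of_forall fun t => ?_)
      simp only
      ring
  have hBI : Integrable fun t => ρ t * (B *ᵥ w (x - proj t)) i :=
    integrable_mollify hρcont hρc (f := fun y => (B *ᵥ w y) i) (by fun_prop) x
  rw [hBeq, hD, ← integral_add hBI hI]
  set A := lagrangian H i x v + c - lam * w x i + ε with hA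
  calc _ ≤ ∫ t, ρ t * A := by
        refine integral_mono_ae (hBI.add hI)
          ((hρcont.integrable_of_hasCompactSupport hρc).mul_const A) ?_
        filter_upwards [ae_differentiableAt_neg hgl] with t ht
        by_cases hρt : ρ t = 0
        · simp [hρt]
        · have htδ : t ∈ Metric.ball (0 : Vec N) δ := by
            have : t ∈ Function.support ρ := hρt
            rwa [hρdef, b.support_normed_eq] at this
          set q := (InnerProductSpace.toDual ℝ (Vec N)).symm (fderiv ℝ g (-t)) with hq
          have hqv : ∀ e, fderiv ℝ g (-t) e = inner ℝ q e := fun e => by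
            rw [hq, InnerProductSpace.toDual_symm_apply]
          have hqD : HasFDerivAt g (innerSL ℝ q) (-t) :=
            ht.hasFDerivAt.congr_fderiv (ContinuousLinearMap.ext fun e => by simp [hqv])
          have hqK : ‖q‖ ≤ K := by
            rw [hq, LinearIsometryEquiv.norm_map]
            have := norm_fderiv_le_of_lipschitz ℝ hgl (x₀ := -t)
            rwa [Real.coe_toNNReal _ hK0] at this
          have h1 := hw _ i q (mem_superdiff_of_hasFDerivAt (f := fun y => w y i) hqD)
          rw [proj_neg, ← sub_eq_add_neg, mulVec_add_smul_one] at h1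
          have h2 := hball t htδ (x, q) ⟨trivial, by simpa using hqK⟩ i
          have h3 := inner_le_lagrangian_add hH i x q v
          simp only at h2
          rw [← mul_add, hqv]
          refine mul_le_mul_of_nonneg_left ?_ (hρ0 t)
          rw [hA]
          linarith
    _ = A := by rw [integral_mul_const, hρ1, one_mul]

end Mollification

/-! ### Closed measures and the action of subsolutions -/

section ClosedMeasures

variable {N m : ℕ} {H : Fin m → Torus N → Vec N → ℝ} {B : Matrix (Fin m) (Fin m) ℝ} {lam c : ℝ}

/-- The test function `(x, v, i) ↦ (Bφ(x))_i + ⟨Dφ_i(x), v⟩` in the definition of closed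
measures. -/
def testFun (B : Matrix (Fin m) (Fin m) ℝ) (φ : Torus N → Fin m → ℝ) (z : Phase N m) : ℝ :=
  (B *ᵥ φ z.1) z.2.2 + dirDeriv (fun x => φ x z.2.2) z.1 z.2.1

lemma continuous_mulVec_C1 {φ : Torus N → Fin m → ℝ} (hφ : ∀ i, IsC1 fun x => φ x i) :
    Continuous fun z : Phase N m => (B *ᵥ φ z.1) z.2.2 := by
  have : Continuous φ := continuous_pi fun i => (hφ i).continuous
  refine continuous_phase (F := fun i x _ => (B *ᵥ φ x) i) fun i => ?_
  fun_prop

lemma continuous_testFun {φ : Torus N → Fin m → ℝ} (hφ : ∀ i, IsC1 fun x => φ x i) :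
    Continuous (testFun B φ) :=
  (continuous_mulVec_C1 hφ).add
    (continuous_phase (F := fun i x v => dirDeriv (fun y => φ y i) x v)
      fun i => (hφ i).continuous_dirDeriv)

lemma testFun_add {φ ψ : Torus N → Fin m → ℝ} (hφ : ∀ i, IsC1 fun x => φ x i)
    (hψ : ∀ i, IsC1 fun x => ψ x i) (z : Phase N m) :
    testFun B (φ + ψ) z = testFun B φ z + testFun B ψ z := by
  have h1 := fderiv_add ((hφ z.2.2).differentiableAt z.1) ((hψ z.2.2).differentiableAt z.1)
  have h2 : dirDeriv (fun x => (φ + ψ) x z.2.2) z.1 z.2.1 =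
      dirDeriv (fun x => φ x z.2.2) z.1 z.2.1 + dirDeriv (fun x => ψ x z.2.2) z.1 z.2.1 := by
    simp only [dirDeriv]
    rw [← add_apply, ← h1]
    rfl
  rw [testFun, h2, testFun, testFun, Pi.add_apply, Matrix.mulVec_add, Pi.add_apply]
  ring

lemma testFun_smul {φ : Torus N → Fin m → ℝ} (hφ : ∀ i, IsC1 fun x => φ x i) (a : ℝ)
    (z : Phase N m) : testFun B (a • φ) z = a * testFun B φ z := by
  have h1 := fderiv_const_smul ((hφ z.2.2).differentiableAt z.1) a
  have h2 : dirDeriv (fun x => (a • φ) x z.2.2) z.1 z.2.1 =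
      a * dirDeriv (fun x => φ x z.2.2) z.1 z.2.1 := by
    simp only [dirDeriv]
    rw [← smul_eq_mul, ← smul_apply, ← h1]
    rfl
  rw [testFun, h2, testFun, Pi.smul_apply, Matrix.mulVec_smul, Pi.smul_apply, smul_eq_mul]
  ring

lemma IsClosedMeasure.integrable_testFun {μ : Measure (Phase N m)} (hμ : IsClosedMeasure B μ)
    {φ : Torus N → Fin m → ℝ} (hφ : ∀ i, IsC1 fun x => φ x i) : Integrable (testFun B φ) μ := by
  have := hμ.prob
  have hφc : Continuous φ := continuous_pi fun i => (hφ i).continuous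
  have hB : Continuous fun x => B *ᵥ φ x := by fun_prop
  obtain ⟨C, hC⟩ := (isCompact_range hB).isBounded.exists_norm_le
  choose D hD0 hD using fun i => (hφ i).exists_abs_dirDeriv_le
  refine Integrable.mono' ((integrable_const C).add (hμ.integrable_norm.const_mul (∑ i, D i)))
    (continuous_testFun hφ).aestronglyMeasurable (Eventually.of_forall fun z => ?_)
  refine (norm_add_le _ _).trans (add_le_add ?_ ?_)
  · exact (norm_le_pi_norm _ _).trans (hC _ ⟨z.1, rfl⟩)
  · refine (hD z.2.2 z.1 z.2.1).trans (mul_le_mul_of_nonneg_right ?_ (norm_nonneg _))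
    exact Finset.single_le_sum (fun i _ => hD0 i) (Finset.mem_univ _)

lemma integrable_eval {μ : Measure (Phase N m)} [IsFiniteMeasure μ] (w : VecFun N m) :
    Integrable (fun z : Phase N m => w z.1 z.2.2) μ := by
  refine Integrable.mono' (integrable_const ‖w‖) ?_ (Eventually.of_forall fun z => ?_)
  · refine (continuous_phase (F := fun i x _ => w x i) fun i => ?_).aestronglyMeasurable
    fun_prop
  · exact (norm_le_pi_norm _ _).trans (w.norm_coe_le_norm z.1)

/-- A subsolution of the discounted system bounds the action of closed measures from below. -/
lemma IsSubsolution.mul_integral_le (hH : HamiltonianAssumptions H) {w : VecFun N m}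
    (hw : IsSubsolution H B lam c w) {μ : Measure (Phase N m)} (hμ : IsClosedMeasure B μ)
    (hL : Integrable (fun z : Phase N m => lagrangian H z.2.2 z.1 z.2.1) μ) :
    lam * ∫ z : Phase N m, w z.1 z.2.2 ∂μ
      ≤ (∫ z : Phase N m, lagrangian H z.2.2 z.1 z.2.1 ∂μ) + c := by
  have := hμ.prob
  refine le_of_forall_pos_le_add fun ε hε => ?_
  obtain ⟨φ, hφ, h⟩ := hw.exists_C1 hH hε
  have hwI := (integrable_eval (μ := μ) w).const_mul lam
  have hI1 : Integrable (fun z : Phase N m => lagrangian H z.2.2 z.1 z.2.1 + c) μ :=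
    hL.add (integrable_const c)
  have hI2 : Integrable (fun z : Phase N m =>
      lagrangian H z.2.2 z.1 z.2.1 + c - lam * w z.1 z.2.2) μ := hI1.sub hwI
  have h1 : ∫ z, testFun B φ z ∂μ ≤ ∫ z : Phase N m,
      (lagrangian H z.2.2 z.1 z.2.1 + c - lam * w z.1 z.2.2 + ε) ∂μ :=
    integral_mono (hμ.integrable_testFun hφ) (hI2.add (integrable_const ε))
      fun z => h z.1 z.2.1 z.2.2
  rw [integral_add hI2 (integrable_const ε), integral_sub hI1 hwI,
    integral_add hL (integrable_const c), integral_const_mul] at h1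
  have h2 : ∫ z, testFun B φ z ∂μ = 0 := hμ.closed φ hφ
  simp only [integral_const, probReal_univ, one_smul] at h1
  linarith

end ClosedMeasures

/-! ### A minimax theorem on compact spaces -/

section Minimax

variable {X : Type*} [TopologicalSpace X] [CompactSpace X] [T2Space X] [MeasurableSpace X]
  [BorelSpace X]

/-- If no element of a linear space `V` of continuous functions lies strictly below `G`, then some
probability measure annihilates `V` and gives `G` a nonpositive integral. It is obtained by
separating the coset `G + V` from the open cone of positive functions. -/
theorem exists_measure_annihilating (V : Submodule ℝ C(X, ℝ)) (G : C(X, ℝ))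
    (h : ∀ F ∈ V, ∃ x, G x ≤ F x) :
    ∃ μ : Measure X, IsProbabilityMeasure μ ∧ (∀ F ∈ V, ∫ x, F x ∂μ = 0) ∧ ∫ x, G x ∂μ ≤ 0 := by
  have hne : Nonempty X := ⟨(h 0 V.zero_mem).choose⟩
  set s : Set C(X, ℝ) := {f | ∀ x, 0 < f x} with hs
  set t : Set C(X, ℝ) := {f | G - f ∈ V} with ht
  have hsc : Convex ℝ s := by
    intro f hf g hg a b ha hb hab x
    have h1 := hf x
    have h2 := hg x
    simp only [ContinuousMap.add_apply, ContinuousMap.smul_apply, smul_eq_mul]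
    rcases ha.eq_or_lt with rfl | ha'
    · rw [show b = 1 by linarith]
      simpa using h2
    · nlinarith [mul_nonneg hb h2.le, mul_pos ha' h1]
  have hso : IsOpen s := by
    have h1 := ContinuousMap.isOpen_setOfPred_mapsTo (X := X) (Y := ℝ) isCompact_univ
      (isOpen_Ioi (a := (0 : ℝ)))
    convert h1 using 1
    ext f
    exact ⟨fun hf x _ => hf x, fun hf x => hf (Set.mem_univ x)⟩
  have htc : Convex ℝ t := by
    intro f hf g hg a b ha hb hab
    have h1 : G - (a • f + b • g) = a • (G - f) + b • (G - g) := by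
      have : G = (a + b) • G := by rw [hab, one_smul]
      conv_lhs => rw [this]
      module
    rw [ht, Set.mem_ofPred_eq, h1]
    exact V.add_mem (V.smul_mem a hf) (V.smul_mem b hg)
  have hdisj : Disjoint s t := by
    rw [Set.disjoint_left]
    intro f hf hft
    obtain ⟨x, hx⟩ := h _ hft
    have := hf x
    simp only [ContinuousMap.sub_apply] at hx
    linarith
  obtain ⟨l, r, hl1, hl2⟩ := geometric_hahn_banach_open hsc hso htc hdisj
  -- scaling elements of the cone towards infinity and towards zero
  have hneg : ∀ f ∈ s, l f ≤ 0 := by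
    intro f hf
    by_contra! hpos
    have h1 : (max (r / l f) 0 + 1) • f ∈ s := fun x => by
      have := hf x
      simp only [ContinuousMap.smul_apply, smul_eq_mul]
      positivity
    have h2 := hl1 _ h1
    rw [map_smul, smul_eq_mul] at h2
    have h3 : r / l f * l f = r := div_mul_cancel₀ _ hpos.ne'
    have h4 := le_max_left (r / l f) 0
    nlinarith
  have hr : 0 ≤ r := by
    by_contra! hr
    have h1 : (1 : C(X, ℝ)) ∈ s := fun x => by simp
    have h2 := hneg _ h1
    have h3 : 0 < (-r) / (1 + |l 1|) := div_pos (by linarith) (by positivity)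
    have h4 : ((-r) / (1 + |l 1|)) • (1 : C(X, ℝ)) ∈ s := fun x => by simpa using h3
    have h5 := hl1 _ h4
    rw [map_smul, smul_eq_mul, div_mul_eq_mul_div, div_lt_iff₀ (by positivity),
      abs_of_nonpos h2] at h5
    nlinarith
  have hneg' : ∀ f : C(X, ℝ), (∀ x, 0 ≤ f x) → l f ≤ 0 := by
    intro f hf
    refine le_of_forall_pos_le_add fun ε hε => ?_
    have h3 : 0 < ε / (1 + |l 1|) := by positivity
    have h1 : f + (ε / (1 + |l 1|)) • (1 : C(X, ℝ)) ∈ s := fun x => by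
      have := hf x
      simp only [ContinuousMap.add_apply, ContinuousMap.smul_apply, ContinuousMap.one_apply,
        smul_eq_mul, mul_one]
      linarith
    have h2 := hneg _ h1
    rw [map_add, map_smul, smul_eq_mul] at h2
    have h4 : ε / (1 + |l 1|) * (1 + |l 1|) = ε := div_mul_cancel₀ _ (by positivity)
    nlinarith [neg_abs_le (l 1)]
  have hG : 0 ≤ l G := hr.trans (hl2 G (by simp [ht]))
  have hV : ∀ F ∈ V, l F = 0 := by
    have h1 : ∀ F ∈ V, ∀ a : ℝ, 0 ≤ l G - a * l F := by
      intro F hF a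
      have h2 := hr.trans (hl2 (G - a • F) (by simpa [ht] using V.smul_mem a hF))
      simpa using h2
    intro F hF
    by_contra hne0
    have h2 := h1 F hF ((l G + 1) / l F)
    rw [div_mul_cancel₀ _ hne0] at h2
    linarith
  have h1neg : l 1 < 0 := by
    refine lt_of_le_of_ne (hneg 1 fun x => by simp) fun h0 => ?_
    have hzero : ∀ f, l f ≤ 0 := by
      intro f
      have h2 := hneg' (f + ‖f‖ • (1 : C(X, ℝ))) fun x => by
        have := (abs_le.1 (f.norm_coe_le_norm x)).1
        simp only [ContinuousMap.add_apply, ContinuousMap.smul_apply, ContinuousMap.one_apply,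
          smul_eq_mul, mul_one]
        linarith
      simpa [h0] using h2
    have h3 := hl1 1 fun x => by simp
    have h4 := hl2 G (by simp [ht])
    have h5 := hzero G
    rw [h0] at h3
    linarith
  let Λ : CompactlySupportedContinuousMap X ℝ →ₚ[ℝ] ℝ := PositiveLinearMap.mk₀
    { toFun := fun g => (l 1)⁻¹ * l (g : C(X, ℝ))
      map_add' := fun f g => by
        rw [← mul_add, ← map_add]; rfl
      map_smul' := fun a f => by
        rw [RingHom.id_apply, smul_eq_mul, ← mul_assoc, mul_comm a, mul_assoc, ← smul_eq_mul a,
          ← map_smul]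
        rfl }
    fun f hf => mul_nonneg_of_nonpos_of_nonpos (inv_nonpos.2 h1neg.le) (hneg' _ fun x => hf x)
  have hΛ : ∀ f : C(X, ℝ), ∫ x, f x ∂(RealRMK.rieszMeasure Λ) = (l 1)⁻¹ * l f := fun f =>
    RealRMK.integral_rieszMeasure Λ (CompactlySupportedContinuousMap.continuousMapEquiv f)
  refine ⟨RealRMK.rieszMeasure Λ, ⟨?_⟩, fun F hF => by rw [hΛ, hV F hF, mul_zero], ?_⟩
  · have h2 := hΛ 1
    rw [inv_mul_cancel₀ h1neg.ne] at h2
    simp only [ContinuousMap.one_apply, integral_const, smul_eq_mul, mul_one] at h2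
    rw [Measure.real, ENNReal.toReal_eq_one_iff] at h2
    exact h2
  · rw [hΛ]
    exact mul_nonpos_of_nonpos_of_nonneg (inv_nonpos.2 h1neg.le) hG

end Minimax

/-! ### Linear algebra of the coupling matrix -/

section Coupling

variable {m : ℕ} {B : Matrix (Fin m) (Fin m) ℝ}

lemma CouplingAssumptions.mulVec_eq_sum_sub (hB : CouplingAssumptions B) (a : Fin m → ℝ)
    (i : Fin m) : (B *ᵥ a) i = ∑ j, B i j * (a j - a i) := by
  simp only [mul_sub, Finset.sum_sub_distrib, ← Finset.sum_mul, hB.row_sum, zero_mul, sub_zero]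
  rfl

lemma CouplingAssumptions.mulVec_nonpos_of_forall_le (hB : CouplingAssumptions B)
    {a : Fin m → ℝ} {i : Fin m} (ha : ∀ j, a i ≤ a j) : (B *ᵥ a) i ≤ 0 := by
  rw [hB.mulVec_eq_sum_sub]
  refine Finset.sum_nonpos fun j _ => ?_
  rcases eq_or_ne j i with rfl | hj
  · simp
  · exact mul_nonpos_of_nonpos_of_nonneg (hB.offDiag_nonpos i j hj) (sub_nonneg.2 (ha j))

/-- By irreducibility, an upper bound on `Ba` bounds the oscillation of `a`: starting from the
maximal entry, the bound spreads along nonzero off-diagonal entries, one index at a time. -/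
lemma CouplingAssumptions.exists_oscillation_le (hB : CouplingAssumptions B) (C : ℝ) :
    ∃ D, 0 ≤ D ∧ ∀ a : Fin m → ℝ, (∀ i, (B *ᵥ a) i ≤ C) → ∀ i j, a i - a j ≤ D := by
  obtain ⟨b, hb, hbB⟩ : ∃ b > 0, ∀ i j, B i j ≠ 0 → b ≤ |B i j| := by
    rcases ({z : Fin m × Fin m | B z.1 z.2 ≠ 0} : Set _).eq_empty_or_nonempty with he | hne
    · exact ⟨1, one_pos, fun i j hij => (Set.eq_empty_iff_forall_notMem.1 he (i, j) hij).elim⟩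
    · obtain ⟨z, hz, hmin⟩ := Set.exists_min_image _ (fun z : Fin m × Fin m => |B z.1 z.2|)
        (Set.toFinite _) hne
      exact ⟨_, abs_pos.2 hz, fun i j hij => hmin (i, j) hij⟩
  obtain ⟨S, hS⟩ := (Set.finite_range fun i => B i i).bddAbove
  have key : ∀ n ≤ m, ∃ D, 0 ≤ D ∧ ∀ a : Fin m → ℝ, (∀ i, (B *ᵥ a) i ≤ C) →
      ∃ I : Finset (Fin m), n ≤ I.card ∧ ∀ i ∈ I, ∀ j, a j - a i ≤ D := by
    intro n
    induction n with
    | zero => exact fun _ => ⟨0, le_rfl, fun a _ => ⟨∅, by simp⟩⟩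
    | succ n ih =>
      intro hn
      obtain ⟨D, hD0, hD⟩ := ih (by omega)
      refine ⟨D + |C + S * D| / b, by positivity, fun a ha => ?_⟩
      obtain ⟨I, hIn, hI⟩ := hD a ha
      have hmono : ∀ i ∈ I, ∀ j, a j - a i ≤ D + |C + S * D| / b := fun i hi j =>
        (hI i hi j).trans (le_add_of_nonneg_right (by positivity))
      by_cases hlt : n + 1 ≤ I.card
      · exact ⟨I, hlt, hmono⟩
      suffices h : ∃ k ∉ I, ∀ j, a j - a k ≤ D + |C + S * D| / b by
        obtain ⟨k, hk, hkj⟩ := h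
        refine ⟨insert k I, by rw [Finset.card_insert_of_notMem hk]; omega, fun i hi => ?_⟩
        rcases Finset.mem_insert.1 hi with rfl | hi
        · exact hkj
        · exact hmono i hi
      rcases I.eq_empty_or_nonempty with rfl | hne
      · have : Nonempty (Fin m) := ⟨⟨0, by omega⟩⟩
        obtain ⟨k, hk⟩ := Finite.exists_max a
        refine ⟨k, by simp, fun j => ?_⟩
        have : 0 ≤ D + |C + S * D| / b := by positivity
        linarith [hk j]
      · obtain ⟨i, hi, k, hk, hik⟩ := hB.irreducible (I : Set (Fin m)) (by simpa using hne)
          (fun h => hlt (by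
            rw [Finset.coe_eq_univ.1 h, Finset.card_univ, Fintype.card_fin]; omega))
        simp only [Finset.mem_coe] at hi hk
        have hki : k ≠ i := fun h => hk (h ▸ hi)
        refine ⟨k, hk, fun j => ?_⟩
        have h1 : ∑ j ∈ Finset.univ.erase i, -B i j * (a i - a j + D) = (B *ᵥ a) i + B i i * D := by
          have h2 : ∑ j, -B i j * (a i - a j + D) = (B *ᵥ a) i := by
            rw [hB.mulVec_eq_sum_sub]
            have h3 : ∑ j, B i j * D = 0 := by rw [← Finset.sum_mul, hB.row_sum, zero_mul]
            rw [← sub_zero (∑ j, B i j * (a j - a i)), ← h3, ← Finset.sum_sub_distrib]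
            exact Finset.sum_congr rfl fun j _ => by ring
          rw [← Finset.add_sum_erase _ _ (Finset.mem_univ i)] at h2
          rw [← h2]
          ring
        have h2 : -B i k * (a i - a k + D) ≤
            ∑ j ∈ Finset.univ.erase i, -B i j * (a i - a j + D) := by
          refine Finset.single_le_sum (f := fun j => -B i j * (a i - a j + D)) (fun j hj => ?_)
            (Finset.mem_erase.2 ⟨hki, Finset.mem_univ k⟩)
          refine mul_nonneg (neg_nonneg.2 (hB.offDiag_nonpos i j (Finset.ne_of_mem_erase hj))) ?_
          linarith [hI i hi j]
        have h3 : b ≤ -B i k := by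
          have := hbB i k hik
          rwa [abs_of_nonpos (hB.offDiag_nonpos i k hki)] at this
        have h4 : B i i ≤ S := hS ⟨i, rfl⟩
        have h5 : 0 ≤ a i - a k + D := by linarith [hI i hi k]
        have h6 : b * (a i - a k + D) ≤ |C + S * D| :=
          calc b * (a i - a k + D) ≤ -B i k * (a i - a k + D) := mul_le_mul_of_nonneg_right h3 h5
            _ ≤ C + S * D := by nlinarith [ha i]
            _ ≤ |C + S * D| := le_abs_self _
        have h7 : a i - a k + D ≤ |C + S * D| / b := by
          rw [le_div_iff₀ hb]; linarith
        linarith [hI i hi j]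
  obtain ⟨D, hD0, hD⟩ := key m le_rfl
  refine ⟨D, hD0, fun a ha i j => ?_⟩
  obtain ⟨I, hcard, hI⟩ := hD a ha
  have hIu : I = Finset.univ := (Finset.card_eq_iff_eq_univ I).1
    (le_antisymm (Finset.card_le_univ I) (by simpa using hcard))
  exact hI j (hIu ▸ Finset.mem_univ j) i

end Coupling

/-! ### A priori bounds for critical subsolutions -/

section Bounds

variable {N m : ℕ} {H : Fin m → Torus N → Vec N → ℝ} {B : Matrix (Fin m) (Fin m) ℝ} {c : ℝ}

/-- Since superdifferentials are nonempty on a dense set, a lower bound on the Hamiltonians bounds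
`Bw` from above for every critical subsolution `w`. -/
lemma IsSubsolution.mulVec_le (hH : HamiltonianAssumptions H) {w : VecFun N m}
    (hw : IsSubsolution H B 0 c w) {C : ℝ} (hC : ∀ i x p, -C ≤ H i x p) (x : Torus N)
    (i : Fin m) : (B *ᵥ w x) i ≤ c + C := by
  obtain ⟨K, hK0, hK⟩ := hw.exists_lipschitz hH
  have hgl := lipschitzWith_lift (f := fun y => w y i) hK0 (hK i) x
  have hdense := Measure.dense_of_ae (hgl.ae_differentiableAt (μ := volume))
  have hcont : Continuous fun h : Vec N => (B *ᵥ w (x + proj h)) i := by fun_prop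
  have hclosed : IsClosed {h : Vec N | (B *ᵥ w (x + proj h)) i ≤ c + C} :=
    isClosed_le hcont continuous_const
  have hall : ∀ h : Vec N, (B *ᵥ w (x + proj h)) i ≤ c + C := by
    intro h
    refine hclosed.closure_subset_iff.2 (fun k hk => ?_) (hdense h)
    have hq : HasFDerivAt (fun h : Vec N => w (x + proj h) i) (innerSL ℝ
        ((InnerProductSpace.toDual ℝ (Vec N)).symm
          (fderiv ℝ (fun h : Vec N => w (x + proj h) i) k))) k :=
      (DifferentiableAt.hasFDerivAt hk).congr_fderiv
        (ContinuousLinearMap.ext fun e => by simp [InnerProductSpace.toDual_symm_apply])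
    have h1 := hw _ i _ (mem_superdiff_of_hasFDerivAt (f := fun y => w y i) hq)
    rw [mulVec_add_smul_one, zero_mul, add_zero] at h1
    have h2 := hC i (x + proj k) ((InnerProductSpace.toDual ℝ (Vec N)).symm
          (fderiv ℝ (fun h : Vec N => w (x + proj h) i) k))
    change (B *ᵥ w (x + proj k)) i ≤ c + C
    linarith
  simpa [proj_zero] using hall 0

/-- The oscillation of critical subsolutions, across points and components, is bounded. -/
lemma exists_oscillation_subsolution_le (hH : HamiltonianAssumptions H)
    (hB : CouplingAssumptions B) (c : ℝ) :
    ∃ C, ∀ w : VecFun N m, IsSubsolution H B 0 c w → ∀ x i y j, w x i ≤ w y j + C := by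
  obtain ⟨C₀, hC₀⟩ := exists_le_hamiltonian hH 0
  obtain ⟨D, hD0, hD⟩ := hB.exists_oscillation_le (c + C₀)
  obtain ⟨K, hK0, hK⟩ := exists_lipschitz_of_subsolution (B := B) hH c
    ((∑ i, ∑ j, |B i j|) * D)
  refine ⟨K * √N + D, fun w hw x i y j => ?_⟩
  have hosc : ∀ x i j, w x i - w x j ≤ D := fun x => hD (w x) fun i =>
    hw.mulVec_le hH (fun i x p => by simpa using hC₀ i x p) x i
  have hlow : ∀ x i, -((∑ i, ∑ j, |B i j|) * D) ≤
      ((B + (0 : ℝ) • (1 : Matrix (Fin m) (Fin m) ℝ)) *ᵥ w x) i := by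
    intro x i
    rw [mulVec_add_smul_one, zero_mul, add_zero, hB.mulVec_eq_sum_sub]
    have h1 : (∑ j, |B i j|) * D ≤ (∑ i, ∑ j, |B i j|) * D :=
      mul_le_mul_of_nonneg_right (Finset.single_le_sum (f := fun i => ∑ j, |B i j|)
        (fun i _ => Finset.sum_nonneg fun j _ => abs_nonneg _) (Finset.mem_univ i)) hD0
    have h2 : -((∑ j, |B i j|) * D) ≤ ∑ j, B i j * (w x j - w x i) := by
      rw [Finset.sum_mul, ← Finset.sum_neg_distrib]
      refine Finset.sum_le_sum fun j _ => ?_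
      have h3 : |w x j - w x i| ≤ D := abs_le.2 ⟨by linarith [hosc x i j], hosc x j i⟩
      have h4 := neg_abs_le (B i j * (w x j - w x i))
      rw [abs_mul] at h4
      have h5 := mul_le_mul_of_nonneg_left h3 (abs_nonneg (B i j))
      linarith
    linarith
  obtain ⟨h, hh, hN⟩ := exists_proj_eq (x - y)
  have h1 := hK 0 w hw hlow i y h
  rw [hh, add_sub_cancel] at h1
  have h2 := mul_le_mul_of_nonneg_left hN hK0
  linarith [hosc y i j]

end Bounds

/-! ### Existence of Mather measures -/

section Mather

variable {N m : ℕ} {H : Fin m → Torus N → Vec N → ℝ} {B : Matrix (Fin m) (Fin m) ℝ} {c : ℝ}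

/-- A supersolution prevents `C¹` functions from being strict subsolutions, and the velocities
witnessing this can be taken in a fixed ball. -/
lemma IsSupersolution.exists_velocity (hH : HamiltonianAssumptions H)
    (hB : CouplingAssumptions B) [Nonempty (Fin m)] {u : VecFun N m}
    (hu : IsSupersolution H B 0 c u) {K : ℝ} (hK0 : 0 ≤ K)
    (hK : ∀ i x h, u (x + proj h) i ≤ u x i + K * ‖h‖) :
    ∃ R, ∀ φ : Torus N → Fin m → ℝ, (∀ i, IsC1 fun x => φ x i) → ∀ ε > 0, ε ≤ 1 →
      ∃ x i v, ‖v‖ ≤ R ∧ lagrangian H i x v + c ≤ testFun B φ (x, v, i) + ε := by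
  obtain ⟨R, hR⟩ := HJSystem.exists_velocity hH K
  refine ⟨R, fun φ hφ ε hε hε1 => ?_⟩
  have hcont : ∀ i, Continuous fun x => u x i - φ x i := fun i => by
    have := (hφ i).continuous
    fun_prop
  have hmin : ∀ i, ∃ x, ∀ y, u x i - φ x i ≤ u y i - φ y i := fun i => by
    obtain ⟨x, -, hx⟩ := isCompact_univ.exists_isMinOn (Set.univ_nonempty (α := Torus N))
      (hcont i).continuousOn
    exact ⟨x, fun y => hx (Set.mem_univ y)⟩
  choose y hy using hmin
  obtain ⟨i, hi⟩ := Finite.exists_min fun i => u (y i) i - φ (y i) i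
  set x := y i
  have hx : ∀ z j, u x i - φ x i ≤ u z j - φ z j := fun z j => (hi j).trans (hy j z)
  set p := (InnerProductSpace.toDual ℝ (Vec N)).symm
    (fderiv ℝ (fun h : Vec N => φ (x + proj h) i) 0) with hp
  have hpv : ∀ v, inner ℝ p v = dirDeriv (fun y => φ y i) x v := fun v => by
    rw [hp, InnerProductSpace.toDual_symm_apply, dirDeriv]
  have hpd : HasFDerivAt (fun h : Vec N => φ (x + proj h) i) (innerSL ℝ p) 0 :=
    ((hφ i).differentiableAt x).hasFDerivAt.congr_fderiv
      (ContinuousLinearMap.ext fun v => by rw [innerSL_apply_apply, hpv, dirDeriv])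
  have hpu : p ∈ subdiff (fun y => u y i) x := by
    have := mem_subdiff_of_isLocalMin (f := fun y => u y i) (x := x) hpd
      (Eventually.of_forall fun h => by simpa [proj_zero] using hx (x + proj h) i)
    simpa [proj_zero] using this
  have h1 := hu x i p hpu
  rw [mulVec_add_smul_one, zero_mul, add_zero] at h1
  obtain ⟨v, hv, hLv⟩ := hR i x p (norm_le_of_mem_subdiff hK0 (hK i x) hpu) ε hε hε1
  refine ⟨x, i, v, hv, ?_⟩
  have h2 := hB.mulVec_nonpos_of_forall_le (a := u x - φ x) (i := i) fun j => hx x j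
  rw [Matrix.mulVec_sub, Pi.sub_apply] at h2
  simp only [testFun]
  rw [← hpv]
  linarith

/-- If the critical system has a solution, some closed measure has action at most `-c`. Its
support is bounded because the solution is Lipschitz. -/
lemma exists_closedMeasure (hH : HamiltonianAssumptions H) (hB : CouplingAssumptions B)
    [Nonempty (Fin m)] {u : VecFun N m} (hu : IsSolution H B 0 c u) :
    ∃ ν : Measure (Phase N m), IsClosedMeasure B ν ∧
      Integrable (fun z : Phase N m => lagrangian H z.2.2 z.1 z.2.1) ν ∧
      ∫ z : Phase N m, lagrangian H z.2.2 z.1 z.2.1 ∂ν ≤ -c := by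
  obtain ⟨K, hK0, hK⟩ := hu.1.exists_lipschitz hH
  obtain ⟨R, hR⟩ := hu.2.exists_velocity hH hB hK0 hK
  let X := Torus N × Metric.closedBall (0 : Vec N) R × Fin m
  have : CompactSpace (Metric.closedBall (0 : Vec N) R) :=
    isCompact_iff_compactSpace.1 (isCompact_closedBall _ _)
  let e : X → Phase N m := fun z => (z.1, z.2.1, z.2.2)
  have he : Continuous e := by fun_prop
  have hLc : Continuous fun z : X => lagrangian H (e z).2.2 (e z).1 (e z).2.1 :=
    (continuous_lagrangian hH).comp he
  let V : Submodule ℝ C(X, ℝ) :=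
    { carrier := {F | ∃ φ : Torus N → Fin m → ℝ, (∀ i, IsC1 fun x => φ x i) ∧
        ∀ z, F z = testFun B φ (e z)}
      add_mem' := by
        rintro F G ⟨φ, hφ, hF⟩ ⟨ψ, hψ, hG⟩
        refine ⟨φ + ψ, fun i => ContDiff.add (hφ i) (hψ i), fun z => ?_⟩
        rw [ContinuousMap.add_apply, hF, hG, testFun_add hφ hψ]
      zero_mem' := by
        refine ⟨0, fun i => contDiff_const, fun z => ?_⟩
        have h0 : ∀ i, IsC1 fun x : Torus N => (0 : Torus N → Fin m → ℝ) x i :=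
          fun i => contDiff_const
        have := testFun_smul (B := B) h0 0 (e z)
        rw [zero_smul, zero_mul] at this
        simp [this]
      smul_mem' := by
        rintro a F ⟨φ, hφ, hF⟩
        refine ⟨a • φ, fun i => ContDiff.const_smul a (hφ i), fun z => ?_⟩
        rw [ContinuousMap.smul_apply, hF, testFun_smul hφ, smul_eq_mul] }
  let G : C(X, ℝ) := ⟨fun z => lagrangian H (e z).2.2 (e z).1 (e z).2.1 + c,
    hLc.add continuous_const⟩
  have hGV : ∀ F ∈ V, ∃ z, G z ≤ F z := by
    rintro F ⟨φ, hφ, hF⟩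
    have hex : ∀ ε > 0, ε ≤ 1 → ∃ z : X, G z ≤ F z + ε := by
      intro ε hε hε1
      obtain ⟨x, i, v, hv, hle⟩ := hR φ hφ ε hε hε1
      exact ⟨(x, ⟨v, by simpa using hv⟩, i), by rw [hF]; exact hle⟩
    obtain ⟨z₀, -⟩ := hex 1 one_pos le_rfl
    obtain ⟨z, -, hz⟩ := isCompact_univ.exists_isMinOn ⟨z₀, Set.mem_univ z₀⟩
      (f := fun z => G z - F z) (by fun_prop)
    refine ⟨z, le_of_forall_pos_le_add fun ε hε => ?_⟩
    obtain ⟨z', hz'⟩ := hex (min ε 1) (by positivity) (min_le_right _ _)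
    have h1 : G z - F z ≤ G z' - F z' := hz (Set.mem_univ z')
    have h2 := min_le_left ε 1
    linarith
  obtain ⟨μ, hμ, hμV, hμG⟩ := exists_measure_annihilating V G hGV
  have hmap : ∀ F : Phase N m → ℝ, Continuous F →
      ∫ z, F z ∂(μ.map e) = ∫ z, F (e z) ∂μ := fun F hF =>
    integral_map he.aemeasurable hF.aestronglyMeasurable
  have hint : ∀ F : Phase N m → ℝ, Continuous F → Integrable F (μ.map e) := fun F hF => by
    rw [integrable_map_measure hF.aestronglyMeasurable he.aemeasurable]
    exact (hF.comp he).integrable_of_hasCompactSupport (HasCompactSupport.of_compactSpace _)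
  refine ⟨μ.map e, ⟨Measure.isProbabilityMeasure_map he.aemeasurable, hint _ (by fun_prop),
    fun φ hφ => ?_⟩, hint _ (continuous_lagrangian hH), ?_⟩
  · refine (hmap _ (continuous_testFun hφ)).trans ?_
    exact hμV ⟨fun z => testFun B φ (e z), (continuous_testFun hφ).comp he⟩
      ⟨φ, hφ, fun z => rfl⟩
  · rw [hmap _ (continuous_lagrangian hH)]
    have h1 : ∫ z, (lagrangian H (e z).2.2 (e z).1 (e z).2.1 + c) ∂μ ≤ 0 := hμG
    rw [integral_add (hLc.integrable_of_hasCompactSupport (HasCompactSupport.of_compactSpace _))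
      (integrable_const c)] at h1
    simp only [integral_const, probReal_univ, one_smul] at h1
    linarith

end Mather

end HJSystem

end

theorem proposition4p2 {N m : ℕ} (H : Fin m → HJSystem.Torus N → HJSystem.Vec N → ℝ)
    (B : Matrix (Fin m) (Fin m) ℝ)
    (hH : HJSystem.HamiltonianAssumptions H) (hB : HJSystem.CouplingAssumptions B)
    (u : HJSystem.VecFun N m) (hu : u ∈ HJSystem.limitSet H B) :
    (∀ μ : Measure (HJSystem.Phase N m), HJSystem.IsMatherMeasure H B μ →
      ∫ z : HJSystem.Phase N m, u z.1 z.2.2 ∂μ ≤ 0) ∧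
    (∀ x i, BddAbove ((fun w : HJSystem.VecFun N m => w x i) ''
      HJSystem.admissibleSubsolutions H B)) ∧
    (∀ x i, u x i ≤ HJSystem.uZero H B x i) := by
  obtain ⟨-, lam, v, hpos, hlam, hv, hvu⟩ := hu
  set c := HJSystem.criticalValue H B with hc
  have hsol : HJSystem.IsSolution H B 0 c u :=
    ⟨HJSystem.IsSubsolution.of_tendsto hH hlam hvu fun k => (hv k).1,
      HJSystem.IsSupersolution.of_tendsto hH hlam hvu fun k => (hv k).2⟩
  have hint : ∀ μ : Measure (HJSystem.Phase N m), HJSystem.IsMatherMeasure H B μ →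
      ∫ z : HJSystem.Phase N m, u z.1 z.2.2 ∂μ ≤ 0 := by
    intro μ hμ
    have hprob := hμ.closed.prob
    have : Nonempty (Fin m) := (nonempty_of_isProbabilityMeasure μ).map fun z => z.2.2
    obtain ⟨ν, hν, hνL, hνc⟩ := HJSystem.exists_closedMeasure hH hB hsol
    have hμc := hμ.minimal ν hν hνL
    refine le_of_forall_pos_le_add fun ε hε => ?_
    obtain ⟨k, hk⟩ := (Metric.tendsto_nhds.1 hvu ε hε).exists
    have h1 := (hv k).1.mul_integral_le hH hμ.closed hμ.integrable
    have h2 : ∫ z : HJSystem.Phase N m, v k z.1 z.2.2 ∂μ ≤ 0 := by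
      by_contra! h
      linarith [mul_pos (hpos k) h]
    have h3 : ∫ z : HJSystem.Phase N m, u z.1 z.2.2 ∂μ ≤
        ∫ z : HJSystem.Phase N m, (v k z.1 z.2.2 + ε) ∂μ := by
      refine integral_mono (HJSystem.integrable_eval u)
        ((HJSystem.integrable_eval (v k)).add (integrable_const ε)) fun z => ?_
      have h4 : dist (v k z.1 z.2.2) (u z.1 z.2.2) ≤ ε :=
        (dist_le_pi_dist _ _ z.2.2).trans ((ContinuousMap.dist_apply_le_dist z.1).trans hk.le)
      rw [Real.dist_eq] at h4
      linarith [(abs_le.1 h4).1]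
    rw [integral_add (HJSystem.integrable_eval (v k)) (integrable_const ε)] at h3
    simp only [integral_const, probReal_univ, one_smul] at h3
    linarith
  have hbdd : ∀ x i, BddAbove ((fun w : HJSystem.VecFun N m => w x i) ''
      HJSystem.admissibleSubsolutions H B) := by
    intro x i
    have : Nonempty (Fin m) := ⟨i⟩
    obtain ⟨ν, hν, hνL, hνc⟩ := HJSystem.exists_closedMeasure hH hB hsol
    have hνprob := hν.prob
    have hνM : HJSystem.IsMatherMeasure H B ν := ⟨hν, hνL, fun μ hμ hμL => by
      have := hsol.1.mul_integral_le hH hμ hμL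
      linarith⟩
    obtain ⟨C, hC⟩ := HJSystem.exists_oscillation_subsolution_le hH hB c
    refine ⟨C, ?_⟩
    rintro _ ⟨w, ⟨hw, hwν⟩, rfl⟩
    obtain ⟨z, hz⟩ := exists_le_integral (HJSystem.integrable_eval (μ := ν) w)
    have h1 := hC w hw x i z.1 z.2.2
    have h2 := hwν ν hνM
    simp only
    linarith
  exact ⟨hint, hbdd, fun x i => le_csSup (hbdd x i) ⟨u, ⟨hsol.1, hint⟩, rfl⟩⟩
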